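/- Machines are deterministic multi-tape Turing machines. A *parameterized problem* is a pair $(X,\kappa)$ where $X\subseteq\{0,1\}^*$ and $\kappa:\{0,1\}^*\to\mathbb N$ is computable in polynomial time with $\kappa(x)\le |x|$ for all $x$; for an instance $x$ we write $n=|x|$ and $k=\kappa(x)$. For a function $f:\mathbb N\to\mathbb N$, a *Turing kernelization of size $f$* for $(X,\kappa)$ is a polynomial-time oracle Turing machine that, given the oracle $X$, decides $X$ and that on every input $x$ only queries the oracle about strings of length at most $f(\kappa(x))$. It is *polynomial* if $f$ is a polynomial. A function $g:\mathbb N\to\mathbb N$ is *time-constructible* if the map from $1^k$ to the binary representation of $g(k)$ can be computed in time $O(g(k))$; and $g(k)\in 2^{o(k)}$ means that $g(k)\le 2^{h(k)}$ for all sufficiently large $k$ and some $h(k)\in o(k)$. **Theorem 5.** For every time-constructible function $g(k)\in 2^{o(k)}$, there is a parameterized problem that is solvable in time $O(2^k n)$ but admits no Turing kernelization of size $g(k)$. In particular, there is a parameterized problem that is solvable in time $O(2^k n)$ but admits no polynomial Turing kernelization (that is, for no polynomial $p$ does it admit a Turing kernelization of size $p$). -/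

import Mathlib

open Asymptotics Filter

namespace ParamComplexity

/-- Symbols on the tapes of a machine: the blank, the two bits, and finitely many further symbols
(the elements of `A`). -/
inductive TapeSymbol (A : Type) : Type where
  | blank : TapeSymbol A
  | bit (b : Bool) : TapeSymbol A
  | extra (a : A) : TapeSymbol A

instance TapeSymbol.instInhabited (A : Type) : Inhabited (TapeSymbol A) := ⟨TapeSymbol.blank⟩

/-- The longest initial block of bits of a list of tape symbols. -/
def leadingBits {A : Type} : List (TapeSymbol A) → List Bool
  | TapeSymbol.bit b :: l => b :: leadingBits l
  | _ => []

theorem leadingBits_append_blanks {A : Type} (l : List (TapeSymbol A)) (n : ℕ) :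
    leadingBits (l ++ List.replicate n default) = leadingBits l := by
  induction l with
  | nil => cases n <;> rfl
  | cons a l ih =>
    cases a with
    | blank => rfl
    | bit b => exact congrArg (List.cons b) ih
    | extra a => rfl

/-- The bit string on a tape that starts in the scanned cell and extends to the right up to
(and excluding) the first cell that does not hold a bit. -/
def tapeBits {A : Type} (T : Turing.Tape (TapeSymbol A)) : List Bool :=
  T.right₀.liftOn leadingBits (by
    rintro a b ⟨n, rfl⟩
    exact (leadingBits_append_blanks a n).symm)

/-- What a machine does in one step, given its state and the scanned symbols:
* `move q' w`: enter state `q'`, and on every tape `i` write the symbol `(w i).1` into the scanned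
  cell and then move the head as told by `(w i).2` (`none`: the head stays);
* `query y n`: ask the oracle about the string on the query tape, and enter state `y` if the answer
  is yes and state `n` if it is no;
* `halt b`: stop; a machine that decides a language accepts if `b` is `true` and rejects if `b` is
  `false`. -/
inductive Action (Q K A : Type) : Type where
  | move (q' : Q) (w : K → TapeSymbol A × Option Turing.Dir) : Action Q K A
  | query (y n : Q) : Action Q K A
  | halt (b : Bool) : Action Q K A

/-- A deterministic multi-tape oracle Turing machine. It has a finite set `Q` of states, finitely
many two-way infinite tapes (indexed by `K`), a finite tape alphabet, and a transition function. -/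
structure OracleTM where
  /-- states -/
  Q : Type
  [finQ : Finite Q]
  /-- names of the tapes -/
  K : Type
  [finK : Finite K]
  [decK : DecidableEq K]
  /-- tape symbols besides the bits and the blank -/
  A : Type
  [finA : Finite A]
  /-- the tape that holds the input at the start -/
  inTape : K
  /-- the tape that holds the oracle queries -/
  queryTape : K
  /-- the tape that holds the output at the end (for a machine that computes a function) -/
  outTape : K
  /-- the initial state -/
  start : Q
  /-- the transition function -/
  δ : Q → (K → TapeSymbol A) → Action Q K A

namespace OracleTM

variable (M : OracleTM)

instance instDecidableEqK : DecidableEq M.K := M.decK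

/-- A configuration: the state, and the tapes with their heads. -/
structure Cfg where
  /-- the current state -/
  state : M.Q
  /-- the tapes, each centred at its head -/
  tape : M.K → Turing.Tape (TapeSymbol M.A)

/-- The initial configuration: the input is on the input tape, with the head on its first symbol,
and everything else is blank. -/
def init (x : List Bool) : M.Cfg where
  state := M.start
  tape i := if i = M.inTape then Turing.Tape.mk₁ (x.map TapeSymbol.bit) else Turing.Tape.mk₁ []

/-- The action that is due in a configuration. -/
def action (c : M.Cfg) : Action M.Q M.K M.A :=
  M.δ c.state (fun i => (c.tape i).head)

open Classical in
/-- One step with oracle `O`. A halted configuration stays as it is. -/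
noncomputable def step (O : Set (List Bool)) (c : M.Cfg) : M.Cfg :=
  match M.action c with
  | Action.move q' w =>
    { state := q'
      tape := fun i =>
        match (w i).2 with
        | none => (c.tape i).write (w i).1
        | some d => ((c.tape i).write (w i).1).move d }
  | Action.query y n =>
    { c with state := if tapeBits (c.tape M.queryTape) ∈ O then y else n }
  | Action.halt _ => c

/-- The configuration after `t` steps (or on halting, if that is earlier) with oracle `O` on
input `x`. -/
noncomputable def cfgAt (O : Set (List Bool)) (x : List Bool) (t : ℕ) : M.Cfg :=
  (M.step O)^[t] (M.init x)

/-- `M` with oracle `O` halts on `x` after at most `t` steps, with verdict `b`. -/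
def HaltsWithin (O : Set (List Bool)) (x : List Bool) (t : ℕ) (b : Bool) : Prop :=
  M.action (M.cfgAt O x t) = Action.halt b

/-- In its computation on `x` with oracle `O`, `M` at some time asks the oracle about `w`. -/
def Queries (O : Set (List Bool)) (x w : List Bool) : Prop :=
  ∃ t y n, M.action (M.cfgAt O x t) = Action.query y n ∧
    tapeBits ((M.cfgAt O x t).tape M.queryTape) = w

/-- `M` with oracle `O` decides the language `X`, taking at most `T x` steps on every input `x`. -/
def DecidesInTime (O X : Set (List Bool)) (T : List Bool → ℕ) : Prop :=
  ∀ x, ∃ b, M.HaltsWithin O x (T x) b ∧ (b = true ↔ x ∈ X)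

/-- `M` is an ordinary Turing machine: no transition queries the oracle. -/
def OracleFree : Prop :=
  ∀ q s y n, M.δ q s ≠ Action.query y n

/-- The ordinary machine `M` on input `x` halts after at most `t` steps with output `y`. -/
def OutputsWithin (x y : List Bool) (t : ℕ) : Prop :=
  (∃ b, M.HaltsWithin ∅ x t b) ∧ tapeBits ((M.cfgAt ∅ x t).tape M.outTape) = y

end OracleTM

/-- `f : {0,1}* → ℕ` is computable in polynomial time, with values written in binary. -/
def PolyTimeComputable (f : List Bool → ℕ) : Prop :=
  ∃ M : OracleTM, M.OracleFree ∧ ∃ p : Polynomial ℕ,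
    ∀ x, M.OutputsWithin x (f x).bits (p.eval x.length)

/-- `g : ℕ → ℕ` is time-constructible: on input `1^k`, the binary representation of `g k` can be
computed in time `O(g k)`. (The summand `C` only allows for a constant time where `g k = 0`.) -/
def TimeConstructible (g : ℕ → ℕ) : Prop :=
  ∃ M : OracleTM, M.OracleFree ∧ ∃ C : ℕ,
    ∀ k, M.OutputsWithin (List.replicate k true) (g k).bits (C * g k + C)

/-- `g ∈ 2^{o(k)}`. -/
def SubexponentialGrowth (g : ℕ → ℕ) : Prop :=
  ∃ h : ℕ → ℝ, h =o[atTop] (fun k : ℕ => (k : ℝ)) ∧ ∀ᶠ k in atTop, (g k : ℝ) ≤ (2 : ℝ) ^ h k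

/-- A parameterized problem: a language `X` over `{0,1}` with a parameterization `κ`, that is, a
polynomial-time computable function with `κ x ≤ |x|`. -/
structure ParamProblem where
  /-- the set of yes-instances -/
  X : Set (List Bool)
  /-- the parameterization -/
  κ : List Bool → ℕ
  polyTime_κ : PolyTimeComputable κ
  κ_le_length : ∀ x, κ x ≤ x.length

namespace ParamProblem

variable (P : ParamProblem)

/-- `P` is solvable in time `O(2^k n)`, where `k = κ x` and `n = |x|`. (The summand `C` only
matters for the empty input, where `2^k n = 0`.) -/
def SolvableInTwoPowMul : Prop :=
  ∃ M : OracleTM, M.OracleFree ∧ ∃ C : ℕ,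
    M.DecidesInTime ∅ P.X (fun x => C * (2 ^ P.κ x * x.length) + C)

/-- `P` has a Turing kernelization of size `f`: a polynomial-time oracle machine that decides `P.X`
with oracle `P.X` and on every input `x` only asks queries of length at most `f (κ x)`. -/
def HasTuringKernelization (f : ℕ → ℕ) : Prop :=
  ∃ M : OracleTM, (∃ p : Polynomial ℕ, M.DecidesInTime P.X P.X (fun x => p.eval x.length)) ∧
    ∀ x w, M.Queries P.X x w → w.length ≤ f (P.κ x)

/-- `P` has a polynomial Turing kernelization. -/
def HasPolynomialTuringKernelization : Prop :=
  ∃ p : Polynomial ℕ, P.HasTuringKernelization (fun k => p.eval k)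

end ParamProblem

end ParamComplexity

/-! The proof is a diagonalization with a sparse set of lengths. The parameter of `x = 1^k 0 p` is
the number `k` of leading ones. The string `x` belongs to `hardProblem` if its length lies in a very
sparse set `S` (`sparseSet`) and a universal machine, running the program `p` on `x` itself, accepts
before a clock with a `k`-bit counter runs out. The clock takes `O(2^k (k + 1))` steps, `S` is
recognized in linear time, and `k ≤ n`; this gives time `O(2^k n)`.

Let `M` be a Turing kernelization of size `g`. Take a large `n` in `S` such that all smaller
elements of `S` are at most `m`, with `2^(c(m+1)) ≤ n` (`sparseSet_gap`). As `g` is subexponential,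
some `k` of order `log n` satisfies `g k < n` although `2^k` exceeds a prescribed polynomial in `n`
(`exists_parameter`). On instances of length `n` with parameter `k`, all queries are shorter than
`n`, so those with answer yes have length at most `m`. Hence a finite automaton with at most
`3^(m+1)` states answers all queries, and `M` with this automaton as its oracle and with its verdict
reversed becomes a program `p` of length `2^(O(m))`, at most `n / 4` (`exists_program_bound`). Let
`x = 1^k 0 p 0…0` have length `n`. If `M` rejects `x`, the universal machine accepts within `2^k`
steps, so `x` is a yes-instance; if `M` accepts `x`, the universal machine never accepts, so `x` is
a no-instance. Either way `M` errs (`not_hasTuringKernelization_hardProblem`). The same problem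
works for every `g`, in particular for polynomials.

To keep the universal machine small, it interprets only a string rewriting system. Oracle machines
are reduced to it through queue automata: one step of `M` is one pass over a queue that holds its
tapes (`queueMachine_run`), and one queue step is one rewriting step (`u_simulates_step`). -/

namespace ParamComplexity

/-! ### Tapes that hold bits -/

/-- Symbols of machines that use bits and blanks only. -/
abbrev Sym := TapeSymbol Empty

/-- Tapes of machines that use bits and blanks only. -/
abbrev BTape := Turing.Tape Sym

open TapeSymbol Turing

/-- Write a symbol and move the head. -/
def act (T : BTape) (w : Sym × Option Dir) : BTape :=
  match w.2 with
  | none => T.write w.1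
  | some d => (T.write w.1).move d

/-- The tape with the bits `l` (in reverse order) to the left of the head and the bits `r` from the
head on. -/
def bitTape (l r : List Bool) : BTape :=
  Tape.mk₂ (l.map bit) (r.map bit)

/-- The tape with the bits `r`, with the head on the blank before them. -/
def leftOf (r : List Bool) : BTape :=
  Tape.mk₂ [] (blank :: r.map bit)

/-- The result of moving the head of `bitTape l r` to the left. -/
def backTape (l r : List Bool) : BTape :=
  match l with
  | [] => leftOf r
  | c :: l => bitTape l (c :: r)

theorem ListBlank_mk_blank : ListBlank.mk [(blank : Sym)] = ListBlank.mk [] :=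
  ListBlank.cons_head_tail (ListBlank.mk ([] : List Sym))

theorem ListBlank_mk_append_blank (l : List Sym) :
    ListBlank.mk (l ++ [blank]) = ListBlank.mk l := by
  induction l with
  | nil => exact ListBlank_mk_blank
  | cons a l ih => rw [List.cons_append, ← ListBlank.cons_mk, ih, ListBlank.cons_mk]

@[simp] theorem bitTape_cons_head (l r : List Bool) (b : Bool) :
    (bitTape l (b :: r)).head = bit b := rfl

@[simp] theorem bitTape_nil_head (l : List Bool) : (bitTape l []).head = blank := rfl

@[simp] theorem leftOf_head (r : List Bool) : (leftOf r).head = blank := rfl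

@[simp] theorem backTape_nil (r : List Bool) : backTape [] r = leftOf r := rfl

@[simp] theorem backTape_cons (l r : List Bool) (c : Bool) :
    backTape (c :: l) r = bitTape l (c :: r) := rfl

@[simp] theorem act_head (T : BTape) : act T (T.head, none) = T := T.write_self

@[simp] theorem act_blank_none_leftOf (r : List Bool) : act (leftOf r) (blank, none) = leftOf r :=
  rfl

@[simp] theorem act_blank_none_bitTape (l : List Bool) :
    act (bitTape l []) (blank, none) = bitTape l [] :=
  act_head (bitTape l [])

@[simp] theorem act_bit_none (l r : List Bool) (b c : Bool) :
    act (bitTape l (b :: r)) (bit c, none) = bitTape l (c :: r) := rfl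

@[simp] theorem act_bit_right (l r : List Bool) (b c : Bool) :
    act (bitTape l (b :: r)) (bit c, some Dir.right) = bitTape (c :: l) r := rfl

@[simp] theorem act_bit_right_nil (l : List Bool) (c : Bool) :
    act (bitTape l []) (bit c, some Dir.right) = bitTape (c :: l) [] := rfl

@[simp] theorem act_blank_right_leftOf (r : List Bool) :
    act (leftOf r) (blank, some Dir.right) = bitTape [] r := by
  simp [act, leftOf, bitTape, Tape.mk₂, ListBlank_mk_blank]

@[simp] theorem act_blank_right (r : List Bool) (b : Bool) :
    act (bitTape [] (b :: r)) (blank, some Dir.right) = bitTape [] r := by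
  simp [act, bitTape, Tape.mk₂, ListBlank_mk_blank]

@[simp] theorem act_bit_left (l r : List Bool) (b c : Bool) :
    act (bitTape l (b :: r)) (bit c, some Dir.left) = backTape l (c :: r) := by
  cases l <;> rfl

@[simp] theorem act_bit_left_nil (l : List Bool) (c : Bool) :
    act (bitTape l []) (bit c, some Dir.left) = backTape l [c] := by
  cases l <;> rfl

@[simp] theorem act_bit_left_leftOf (r : List Bool) (c : Bool) :
    act (leftOf r) (bit c, some Dir.left) = leftOf (c :: r) := rfl

@[simp] theorem act_blank_left (l : List Bool) :
    act (bitTape l []) (blank, some Dir.left) = backTape l [] := by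
  cases l with
  | nil =>
    simp only [act, bitTape, leftOf, backTape, Tape.mk₂, Tape.write_mk', Tape.move_left_mk',
      List.map_nil, ListBlank.tail_mk, List.tail_nil, ListBlank.cons_mk, ListBlank.head_mk]
    exact congrArg _ (ListBlank_mk_append_blank [blank])
  | cons c l =>
    simp only [act, bitTape, backTape, Tape.mk₂, Tape.write_mk', Tape.move_left_mk',
      List.map_nil, List.map_cons, ListBlank.tail_mk, List.tail_nil, ListBlank.cons_mk,
      ListBlank.head_mk]
    exact congrArg _ (ListBlank_mk_append_blank [bit c])

theorem leftOf_nil : leftOf [] = bitTape [] [] := by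
  rw [leftOf, bitTape, Tape.mk₂, Tape.mk₂]
  exact congrArg _ ListBlank_mk_blank

theorem act_head_left (r : List Bool) :
    act (bitTape [] r) ((bitTape [] r).head, some Dir.left) = leftOf r := by
  cases r <;> simp

theorem leadingBits_map_bit {A : Type} (r : List Bool) :
    leadingBits (r.map (bit : Bool → TapeSymbol A)) = r := by
  induction r with
  | nil => rfl
  | cons b r ih => simp [leadingBits, ih]

theorem tapeBits_mk₂ {A : Type} (l r : List (TapeSymbol A)) :
    tapeBits (Tape.mk₂ l r) = leadingBits r := by
  rw [tapeBits, Tape.mk₂, Tape.mk'_right₀]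
  rfl

theorem tapeBits_bitTape (l r : List Bool) : tapeBits (bitTape l r) = r := by
  rw [bitTape, tapeBits_mk₂, leadingBits_map_bit]

/-! ### Runs -/

/-- `t` iterations of `f` lead from `a` to `b`. -/
def Reaches {α : Type*} (f : α → α) (a : α) (t : ℕ) (b : α) : Prop := f^[t] a = b

theorem Reaches.refl {α : Type*} (f : α → α) (a : α) : Reaches f a 0 a := rfl

theorem Reaches.trans {α : Type*} {f : α → α} {a b c : α} {s t : ℕ} (h : Reaches f a s b)
    (h' : Reaches f b t c) : Reaches f a (s + t) c := by
  rw [Reaches, Nat.add_comm, Function.iterate_add_apply, h, h']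

theorem Reaches.step {α : Type*} {f : α → α} {a b c : α} {t : ℕ} (h : f a = b)
    (h' : Reaches f b t c) : Reaches f a (t + 1) c := by
  rw [Reaches, Function.iterate_succ_apply, h, h']

theorem Reaches.single {α : Type*} {f : α → α} {a b : α} (h : f a = b) : Reaches f a 1 b := h

/-! ### Machines without oracle -/

/-- A deterministic multi-tape Turing machine without oracle that uses only bits and blanks. A
transition either halts with a verdict, or goes on. -/
structure BitMachine where
  /-- states -/
  Q : Type
  [finQ : Finite Q]
  /-- tapes -/
  K : Type
  [finK : Finite K]
  [decK : DecidableEq K]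
  /-- the tape with the input -/
  inTape : K
  /-- the initial state -/
  start : Q
  /-- the transition function -/
  δ : Q → (K → Sym) → Bool ⊕ (Q × (K → Sym × Option Dir))

namespace BitMachine

variable (M : BitMachine)

instance : DecidableEq M.K := M.decK
instance : Finite M.K := M.finK
instance : Finite M.Q := M.finQ

/-- Configurations: state and tapes. -/
abbrev Cfg := M.Q × (M.K → BTape)

/-- The transition that is due. -/
def next (c : M.Cfg) : Bool ⊕ (M.Q × (M.K → Sym × Option Dir)) :=
  M.δ c.1 fun i => (c.2 i).head

/-- One step; a halted configuration stays as it is. -/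
def step (c : M.Cfg) : M.Cfg :=
  match M.next c with
  | Sum.inl _ => c
  | Sum.inr (q, w) => (q, fun i => act (c.2 i) (w i))

/-- The verdict of a halted configuration. -/
def verdict (c : M.Cfg) : Option Bool :=
  (M.next c).getLeft?

/-- The initial configuration. -/
def init (x : List Bool) : M.Cfg :=
  (M.start, fun i => if i = M.inTape then bitTape [] x else bitTape [] [])

/-- The configuration after `t` steps. -/
def run (x : List Bool) (t : ℕ) : M.Cfg := M.step^[t] (M.init x)

/-- The machine halts in an accepting configuration. -/
def Accepts (x : List Bool) : Prop := ∃ t, M.verdict (M.run x t) = some true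

variable {M}

theorem step_of_next {c : M.Cfg} {q w} (h : M.next c = Sum.inr (q, w)) :
    M.step c = (q, fun i => act (c.2 i) (w i)) := by
  simp [step, h]

theorem step_eq {c c' : M.Cfg} {w} (h : M.next c = Sum.inr (c'.1, w))
    (h' : ∀ i, act (c.2 i) (w i) = c'.2 i) : M.step c = c' :=
  (step_of_next h).trans (Prod.ext rfl (funext h'))

theorem verdict_eq_some {c : M.Cfg} {b : Bool} : M.verdict c = some b ↔ M.next c = Sum.inl b := by
  simp [verdict, Sum.getLeft?_eq_some_iff]

theorem verdict_eq_none {c : M.Cfg} : M.verdict c = none ↔ ∃ p, M.next c = Sum.inr p := by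
  rw [verdict]
  cases M.next c <;> simp

theorem step_of_verdict {c : M.Cfg} {b : Bool} (h : M.verdict c = some b) : M.step c = c := by
  rw [verdict_eq_some] at h
  simp [step, h]

theorem run_succ (x : List Bool) (t : ℕ) : M.run x (t + 1) = M.step (M.run x t) :=
  Function.iterate_succ_apply' ..

theorem run_add_of_reaches {x : List Bool} {s t : ℕ} {c c' : M.Cfg} (h : M.run x s = c)
    (h' : Reaches M.step c t c') : M.run x (s + t) = c' :=
  Reaches.trans (f := M.step) h h'

theorem run_of_le {x : List Bool} {s t : ℕ} {b : Bool} (h : M.verdict (M.run x s) = some b)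
    (hst : s ≤ t) : M.run x t = M.run x s := by
  induction t, hst using Nat.le_induction with
  | base => rfl
  | succ t _ ih => rw [run_succ, ih, step_of_verdict h]

theorem verdict_of_le {x : List Bool} {s t : ℕ} {b : Bool} (h : M.verdict (M.run x s) = some b)
    (hst : s ≤ t) : M.verdict (M.run x t) = some b := by
  rw [run_of_le h hst, h]

theorem verdict_unique {x : List Bool} {s t : ℕ} {b c : Bool}
    (h : M.verdict (M.run x s) = some b) (h' : M.verdict (M.run x t) = some c) : b = c := by
  have h1 := verdict_of_le h (le_max_left s t)
  rw [verdict_of_le h' (le_max_right s t)] at h1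
  exact (Option.some.inj h1).symm

variable (M)

/-- The machine as an oracle machine that never uses its oracle. -/
def toOracleTM (out : M.K) : OracleTM where
  Q := M.Q
  finQ := M.finQ
  K := M.K
  finK := M.finK
  decK := M.decK
  A := Empty
  inTape := M.inTape
  queryTape := out
  outTape := out
  start := M.start
  δ q s := match M.δ q s with
    | Sum.inl b => Action.halt b
    | Sum.inr (q, w) => Action.move q w

theorem oracleFree_toOracleTM (out : M.K) : (M.toOracleTM out).OracleFree := by
  intro q s y n h
  simp only [toOracleTM] at h
  split at h <;> cases h

/-- A configuration as a configuration of the oracle machine. -/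
def toCfg (out : M.K) (c : M.Cfg) : (M.toOracleTM out).Cfg where
  state := c.1
  tape := c.2

theorem action_toCfg (out : M.K) (c : M.Cfg) : (M.toOracleTM out).action (M.toCfg out c) =
    match M.next c with
    | Sum.inl b => Action.halt b
    | Sum.inr (q, w) => Action.move q w := rfl

theorem step_toCfg (out : M.K) (O : Set (List Bool)) (c : M.Cfg) :
    (M.toOracleTM out).step O (M.toCfg out c) = M.toCfg out (M.step c) := by
  rw [OracleTM.step, action_toCfg, step]
  cases M.next c <;> rfl

theorem cfgAt_toOracleTM (out : M.K) (O : Set (List Bool)) (x : List Bool) (t : ℕ) :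
    (M.toOracleTM out).cfgAt O x t = M.toCfg out (M.run x t) := by
  induction t with
  | zero =>
    simp only [OracleTM.cfgAt, run, Function.iterate_zero, id]
    rfl
  | succ t ih =>
    rw [run_succ, ← step_toCfg M out O, ← ih, OracleTM.cfgAt, OracleTM.cfgAt,
      Function.iterate_succ_apply']

theorem haltsWithin_toOracleTM {out : M.K} {O : Set (List Bool)} {x : List Bool} {t : ℕ}
    {b : Bool} (h : M.verdict (M.run x t) = some b) :
    (M.toOracleTM out).HaltsWithin O x t b := by
  rw [verdict_eq_some] at h
  rw [OracleTM.HaltsWithin, cfgAt_toOracleTM, action_toCfg, h]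

/-! ### Running two machines in lockstep -/

/-- A family indexed by the tapes of `par M₁ M₂ v`, with the value `a` at its input tape, the value
`b` at the input tapes of `M₁` and `M₂`, and the value `c` elsewhere. -/
def spread {β : Type*} (M₁ M₂ : BitMachine) (a b c : β) : Option (M₁.K ⊕ M₂.K) → β
  | none => a
  | some (Sum.inl i) => if i = M₁.inTape then b else c
  | some (Sum.inr i) => if i = M₂.inTape then b else c

/-- Copy the input and run `M₁` and `M₂` in lockstep on the copies, until `v` derives a verdict from
their verdicts. -/
def par (M₁ M₂ : BitMachine) (v : Option Bool → Option Bool → Option Bool) : BitMachine where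
  Q := Bool ⊕ (M₁.Q × M₂.Q)
  K := Option (M₁.K ⊕ M₂.K)
  inTape := none
  start := Sum.inl false
  δ q s :=
    match q with
    | Sum.inl false =>
      match s none with
      | bit b => Sum.inr (Sum.inl false, spread M₁ M₂
          (bit b, some Dir.right) (bit b, some Dir.right) (blank, none))
      | _ => Sum.inr (Sum.inl true, spread M₁ M₂
          (blank, some Dir.left) (blank, some Dir.left) (blank, none))
    | Sum.inl true =>
      match s none with
      | bit b => Sum.inr (Sum.inl true, spread M₁ M₂
          (bit b, some Dir.left) (bit b, some Dir.left) (blank, none))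
      | _ => Sum.inr (Sum.inr (M₁.start, M₂.start), spread M₁ M₂
          (blank, some Dir.right) (blank, some Dir.right) (blank, none))
    | Sum.inr (q₁, q₂) =>
      let r₁ := M₁.δ q₁ fun i => s (some (Sum.inl i))
      let r₂ := M₂.δ q₂ fun i => s (some (Sum.inr i))
      match v r₁.getLeft? r₂.getLeft? with
      | some b => Sum.inl b
      | none => Sum.inr (Sum.inr (r₁.elim (fun _ => q₁) Prod.fst, r₂.elim (fun _ => q₂) Prod.fst),
          fun i => match i with
            | none => (s none, none)
            | some (Sum.inl i) => r₁.elim (fun _ => (s (some (Sum.inl i)), none)) fun p => p.2 i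
            | some (Sum.inr i) => r₂.elim (fun _ => (s (some (Sum.inr i)), none)) fun p => p.2 i)

section par

variable {M₁ M₂ : BitMachine} {v : Option Bool → Option Bool → Option Bool}

theorem act_spread (T₁ T₂ T₃ : BTape) (w₁ w₂ w₃ : Sym × Option Dir) :
    (fun i => act (spread M₁ M₂ T₁ T₂ T₃ i) (spread M₁ M₂ w₁ w₂ w₃ i)) =
      spread M₁ M₂ (act T₁ w₁) (act T₂ w₂) (act T₃ w₃) := by
  funext i
  rcases i with _ | i | i <;> simp only [spread] <;> split_ifs <;> rfl

/-- Configurations in which the copies of the input are being made. -/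
def parCopyCfg (M₁ M₂ : BitMachine) (v : Option Bool → Option Bool → Option Bool) (b : Bool)
    (T T' : BTape) : (par M₁ M₂ v).Cfg :=
  (Sum.inl b, spread M₁ M₂ T T' (bitTape [] []))

/-- Configurations in which the two machines run. -/
def parRunCfg (v : Option Bool → Option Bool → Option Bool) (T : BTape) (c₁ : M₁.Cfg)
    (c₂ : M₂.Cfg) : (par M₁ M₂ v).Cfg :=
  (Sum.inr (c₁.1, c₂.1), fun i => match i with
    | none => T
    | some (Sum.inl i) => c₁.2 i
    | some (Sum.inr i) => c₂.2 i)

theorem par_copy (l r : List Bool) :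
    Reaches (par M₁ M₂ v).step (parCopyCfg M₁ M₂ v false (bitTape l r) (bitTape l []))
      (r.length + 1) (parCopyCfg M₁ M₂ v true (backTape (r.reverse ++ l) [])
        (backTape (r.reverse ++ l) [])) := by
  induction r generalizing l with
  | nil =>
    refine Reaches.single ((step_of_next (q := Sum.inl true)
      (w := spread M₁ M₂ (blank, some Dir.left) (blank, some Dir.left) (blank, none)) rfl).trans ?_)
    refine Prod.ext rfl ((act_spread ..).trans ?_)
    simp [parCopyCfg]
  | cons b r ih =>
    rw [List.reverse_cons, List.append_assoc]
    refine Reaches.step ((step_of_next (q := Sum.inl false)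
      (w := spread M₁ M₂ (bit b, some Dir.right) (bit b, some Dir.right) (blank, none)) rfl).trans ?_)
      (ih (b :: l))
    refine Prod.ext rfl ((act_spread ..).trans ?_)
    simp [parCopyCfg]

theorem par_rewind (l r : List Bool) :
    Reaches (par M₁ M₂ v).step (parCopyCfg M₁ M₂ v true (backTape l r) (backTape l r))
      (l.length + 1) (parRunCfg v (bitTape [] (l.reverse ++ r)) (M₁.init (l.reverse ++ r))
        (M₂.init (l.reverse ++ r))) := by
  induction l generalizing r with
  | nil =>
    refine Reaches.single ((step_of_next (q := Sum.inr (M₁.start, M₂.start))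
      (w := spread M₁ M₂ (blank, some Dir.right) (blank, some Dir.right) (blank, none)) rfl).trans ?_)
    refine Prod.ext rfl ((act_spread ..).trans ?_)
    funext i
    rcases i with _ | i | i <;> simp [spread, init, parRunCfg]
  | cons b l ih =>
    rw [List.reverse_cons, List.append_assoc]
    refine Reaches.step ((step_of_next (q := Sum.inl true)
      (w := spread M₁ M₂ (bit b, some Dir.left) (bit b, some Dir.left) (blank, none)) rfl).trans ?_)
      (ih (b :: r))
    refine Prod.ext rfl ((act_spread ..).trans ?_)
    simp [parCopyCfg]

theorem par_verdict_run (T : BTape) (c₁ : M₁.Cfg) (c₂ : M₂.Cfg) :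
    (par M₁ M₂ v).verdict (parRunCfg v T c₁ c₂) = v (M₁.verdict c₁) (M₂.verdict c₂) := by
  have h1 : (M₁.δ c₁.1 fun i => (c₁.2 i).head).getLeft? = M₁.verdict c₁ := rfl
  have h2 : (M₂.δ c₂.1 fun i => (c₂.2 i).head).getLeft? = M₂.verdict c₂ := rfl
  simp only [verdict, next, par, parRunCfg]
  rw [h1, h2]
  cases v (M₁.verdict c₁) (M₂.verdict c₂) <;> rfl

theorem par_step_run {c₁ : M₁.Cfg} {c₂ : M₂.Cfg} (T : BTape)
    (h : v (M₁.verdict c₁) (M₂.verdict c₂) = none) :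
    (par M₁ M₂ v).step (parRunCfg v T c₁ c₂) = parRunCfg v T (M₁.step c₁) (M₂.step c₂) := by
  have h1 : (M₁.δ c₁.1 fun i => (c₁.2 i).head).getLeft? = M₁.verdict c₁ := rfl
  have h2 : (M₂.δ c₂.1 fun i => (c₂.2 i).head).getLeft? = M₂.verdict c₂ := rfl
  simp only [step, next, par, parRunCfg]
  rw [h1, h2, h]
  simp only
  rcases M₁.δ c₁.1 fun i => (c₁.2 i).head with b₁ | ⟨q₁, w₁⟩ <;>
  rcases M₂.δ c₂.1 fun i => (c₂.2 i).head with b₂ | ⟨q₂, w₂⟩ <;>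
  · congr 1
    funext i
    rcases i with _ | i | i <;> simp

/-- Copying the input and rewinding take `x.length + 1` steps each. A component that has halted
keeps its configuration, so the lockstep run agrees with the two independent runs as long as `v`
gives no verdict. -/
theorem par_run {x : List Bool} {t : ℕ}
    (h : ∀ s < t, v (M₁.verdict (M₁.run x s)) (M₂.verdict (M₂.run x s)) = none) :
    (par M₁ M₂ v).run x (2 * x.length + 2 + t) =
      parRunCfg v (bitTape [] x) (M₁.run x t) (M₂.run x t) := by
  induction t with
  | zero =>
    have h1 := (par_copy (M₁ := M₁) (M₂ := M₂) (v := v) [] x).trans (par_rewind _ _)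
    have h2 : parCopyCfg M₁ M₂ v false (bitTape [] x) (bitTape [] []) = (par M₁ M₂ v).init x := by
      refine Prod.ext rfl (funext fun i => ?_)
      rcases i with _ | i | i <;> simp [parCopyCfg, init, spread, par]
    rw [h2] at h1
    simp only [List.append_nil, List.reverse_reverse, List.length_reverse] at h1
    rw [show 2 * x.length + 2 + 0 = x.length + 1 + (x.length + 1) by ring]
    exact h1
  | succ t ih =>
    rw [← Nat.add_assoc, run_succ, ih fun s hs => h s (hs.trans t.lt_succ_self),
      par_step_run _ (h t t.lt_succ_self), run_succ, run_succ]

theorem par_verdict {x : List Bool} {t : ℕ}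
    (h : ∀ s < t, v (M₁.verdict (M₁.run x s)) (M₂.verdict (M₂.run x s)) = none) :
    (par M₁ M₂ v).verdict ((par M₁ M₂ v).run x (2 * x.length + 2 + t)) =
      v (M₁.verdict (M₁.run x t)) (M₂.verdict (M₂.run x t)) := by
  rw [par_run h, par_verdict_run]

end par

end BitMachine

/-! ### Binary counters of fixed width -/

/-- Phases of a binary counter: just overflown, adding one (carrying), moving back to the least
significant bit, and moving back after an overflow. -/
inductive CounterPhase
  | fresh
  | carry
  | back
  | wrap
  deriving DecidableEq

instance : Finite CounterPhase :=
  Finite.of_surjective ![CounterPhase.fresh, CounterPhase.carry, CounterPhase.back,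
    CounterPhase.wrap] fun q => by cases q <;> decide

open CounterPhase

/-- The transition function of a binary counter. -/
def counterδ : CounterPhase → Sym → CounterPhase × (Sym × Option Dir)
  | fresh, bit b => (back, (bit b, some Dir.left))
  | fresh, _ => (carry, (blank, some Dir.right))
  | back, bit b => (back, (bit b, some Dir.left))
  | back, _ => (carry, (blank, some Dir.right))
  | carry, bit true => (carry, (bit false, some Dir.right))
  | carry, bit false => (back, (bit true, some Dir.left))
  | carry, _ => (wrap, (blank, some Dir.left))
  | wrap, bit b => (wrap, (bit b, some Dir.left))
  | wrap, _ => (fresh, (blank, none))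

/-- One step of a binary counter. -/
def counterStep (c : CounterPhase × BTape) : CounterPhase × BTape :=
  ((counterδ c.1 c.2.head).1, act c.2 (counterδ c.1 c.2.head).2)

/-- A run of the counter in which only the last configuration can be fresh. -/
inductive Quiet : CounterPhase × BTape → ℕ → CounterPhase × BTape → Prop
  | refl (c) : Quiet c 0 c
  | step {c c' t} (hc : c.1 ≠ fresh) (h : Quiet (counterStep c) t c') : Quiet c (t + 1) c'

theorem Quiet.trans {a b c : CounterPhase × BTape} {s t : ℕ} (h : Quiet a s b)
    (h' : Quiet b t c) : Quiet a (s + t) c := by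
  induction h with
  | refl => rwa [Nat.zero_add]
  | step hc _ ih => rw [Nat.add_right_comm]; exact Quiet.step hc (ih h')

theorem Quiet.iterate {c c' : CounterPhase × BTape} {t : ℕ} (h : Quiet c t c') :
    counterStep^[t] c = c' ∧ ∀ s < t, (counterStep^[s] c).1 ≠ fresh := by
  induction h with
  | refl => simp
  | step hc _ ih =>
    refine ⟨ih.1, fun s hs => ?_⟩
    cases s with
    | zero => exact hc
    | succ s => exact ih.2 s (by omega)

theorem Quiet.of_le {c c' : CounterPhase × BTape} {s t : ℕ} (h : Quiet c t c') (hs : s ≤ t) :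
    Quiet c s (counterStep^[s] c) := by
  induction h generalizing s with
  | refl => obtain rfl : s = 0 := by omega
            exact Quiet.refl _
  | step hc _ ih =>
    cases s with
    | zero => exact Quiet.refl _
    | succ s => exact Quiet.step hc (ih (by omega))

theorem quiet_back (a r : List Bool) :
    Quiet (back, backTape a r) (a.length + 1) (carry, bitTape [] (a.reverse ++ r)) := by
  induction a generalizing r with
  | nil =>
    refine Quiet.step (by simp) ?_
    simp only [counterStep, counterδ, backTape_nil, leftOf_head, act_blank_right_leftOf]
    exact Quiet.refl _
  | cons b a ih =>
    refine Quiet.step (by simp) ?_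
    simp only [counterStep, counterδ, backTape_cons, bitTape_cons_head, act_bit_left]
    rw [List.reverse_cons, List.append_assoc]
    exact ih (b :: r)

theorem quiet_wrap (a r : List Bool) :
    Quiet (wrap, backTape a r) (a.length + 1) (fresh, leftOf (a.reverse ++ r)) := by
  induction a generalizing r with
  | nil =>
    refine Quiet.step (by simp) ?_
    simp only [counterStep, counterδ, backTape_nil, leftOf_head, act_blank_none_leftOf]
    exact Quiet.refl _
  | cons b a ih =>
    refine Quiet.step (by simp) ?_
    simp only [counterStep, counterδ, backTape_cons, bitTape_cons_head, act_bit_left]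
    rw [List.reverse_cons, List.append_assoc]
    exact ih (b :: r)

/-- The number with the given bits, least significant bit first. -/
def bitsVal : List Bool → ℕ
  | [] => 0
  | b :: l => b.toNat + 2 * bitsVal l

theorem bitsVal_lt (l : List Bool) : bitsVal l < 2 ^ l.length := by
  induction l with
  | nil => simp [bitsVal]
  | cons b l ih =>
    have := Bool.toNat_le b
    rw [bitsVal, List.length_cons, pow_succ]
    omega

theorem bitsVal_replicate_false (n : ℕ) : bitsVal (List.replicate n false) = 0 := by
  induction n with
  | zero => rfl
  | succ n ih => simp [List.replicate_succ, bitsVal, ih]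

/-- Adding one without change of the width is either possible, or causes an overflow. -/
theorem quiet_carry (a r : List Bool) :
    (∃ r' t, r'.length = r.length ∧ bitsVal r' = bitsVal r + 1 ∧ 1 ≤ t ∧
      t ≤ a.length + 2 * r.length + 2 ∧
      Quiet (carry, bitTape a r) t (carry, bitTape [] (a.reverse ++ r'))) ∨
    (bitsVal r + 1 = 2 ^ r.length ∧ ∃ t, 1 ≤ t ∧ t ≤ a.length + 2 * r.length + 2 ∧
      Quiet (carry, bitTape a r) t
        (fresh, leftOf (a.reverse ++ List.replicate r.length false))) := by
  induction r generalizing a with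
  | nil =>
    refine Or.inr ⟨rfl, a.length + 1 + 1, by omega, by simp, Quiet.step (by simp) ?_⟩
    simp only [counterStep, counterδ, bitTape_nil_head, act_blank_left]
    exact quiet_wrap a []
  | cons b r ih =>
    cases b with
    | false =>
      refine Or.inl ⟨true :: r, a.length + 1 + 1, by simp, by simp [bitsVal]; omega, by omega,
        by simp, Quiet.step (by simp) ?_⟩
      simp only [counterStep, counterδ, bitTape_cons_head, act_bit_left]
      exact quiet_back a (true :: r)
    | true =>
      rcases ih (false :: a) with ⟨r', t, h1, h2, h3, h4, h5⟩ | ⟨h1, t, h2, h3, h4⟩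
      · refine Or.inl ⟨false :: r', t + 1, by simp [h1], by simp [bitsVal, h2]; omega, by omega, ?_,
          Quiet.step (by simp) ?_⟩
        · simp only [List.length_cons] at h4 ⊢; omega
        · simpa [counterStep, counterδ] using h5
      · refine Or.inr ⟨?_, t + 1, by omega, ?_, Quiet.step (by simp) ?_⟩
        · rw [bitsVal, List.length_cons, pow_succ, ← h1, Bool.toNat_true]; omega
        · simp only [List.length_cons] at h3 ⊢; omega
        · simpa [counterStep, counterδ, List.replicate_succ] using h4

/-- `d` is the distance to the largest number of this width, so `d` increments succeed and the next
one overflows. -/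
theorem quiet_count_from (d : ℕ) (l : List Bool) (hd : bitsVal l + d + 1 = 2 ^ l.length) :
    ∃ t, d + 1 ≤ t ∧ t ≤ (d + 1) * (2 * l.length + 2) ∧
      Quiet (carry, bitTape [] l) t (fresh, leftOf (List.replicate l.length false)) := by
  induction d generalizing l with
  | zero =>
    rcases quiet_carry [] l with ⟨r', t, h1, h2, h3, h4, h5⟩ | ⟨h1, t, h2, h3, h4⟩
    · have := bitsVal_lt r'
      rw [h1, h2] at this
      omega
    · exact ⟨t, by omega, by simpa using h3, by simpa using h4⟩
  | succ d ih =>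
    rcases quiet_carry [] l with ⟨r', t, h1, h2, h3, h4, h5⟩ | ⟨h1, t, h2, h3, h4⟩
    · obtain ⟨t', h6, h7, h8⟩ := ih r' (by rw [h1, h2]; omega)
      rw [h1] at h7 h8
      simp only [List.reverse_nil, List.nil_append, List.length_nil] at h4 h5
      exact ⟨t + t', by omega, by linarith, h5.trans h8⟩
    · omega

/-- A counter of width `w` overflows after `2 ^ w` increments. -/
theorem quiet_count (w : ℕ) :
    ∃ t, 2 ^ w ≤ t ∧ t ≤ 2 ^ w * (2 * w + 2) ∧
      Quiet (carry, bitTape [] (List.replicate w false)) t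
        (fresh, leftOf (List.replicate w false)) := by
  have h1 := Nat.one_le_two_pow (n := w)
  obtain ⟨t, h2, h3, h4⟩ := quiet_count_from (2 ^ w - 1) (List.replicate w false) (by
    rw [bitsVal_replicate_false, List.length_replicate]; omega)
  rw [List.length_replicate] at h3 h4
  rw [Nat.sub_add_cancel h1] at h2 h3
  exact ⟨t, h2, h3, h4⟩

/-! ### The parameterization: the number of leading ones -/

/-- The number of ones at the beginning. -/
def leadingOnes : List Bool → ℕ
  | true :: l => leadingOnes l + 1
  | _ => 0

theorem leadingOnes_le_length (x : List Bool) : leadingOnes x ≤ x.length := by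
  induction x with
  | nil => simp [leadingOnes]
  | cons b x ih => cases b <;> simp [leadingOnes, ih]

theorem leadingOnes_replicate_append (k : ℕ) (l : List Bool) :
    leadingOnes (List.replicate k true ++ false :: l) = k := by
  induction k with
  | zero => rfl
  | succ k ih => simp [List.replicate_succ, leadingOnes, ih]

/-- Add one to a binary number, least significant bit first. -/
def incBits : List Bool → List Bool
  | [] => [true]
  | false :: l => true :: l
  | true :: l => false :: incBits l

theorem bits_succ (n : ℕ) : (n + 1).bits = incBits n.bits := by
  induction n using Nat.binaryRec with
  | zero => simp [incBits]
  | bit b n ih =>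
    cases b with
    | false =>
      -- `Nat.bits` has no superfluous zeros, so `0` has no bits at all.
      rcases Nat.eq_zero_or_pos n with rfl | hn
      · simp [incBits]
      · rw [show Nat.bit false n + 1 = 2 * n + 1 by simp [Nat.bit], Nat.bit1_bits,
          show Nat.bit false n = 2 * n by simp [Nat.bit], Nat.bit0_bits n hn.ne', incBits]
    | true =>
      rw [show Nat.bit true n + 1 = 2 * (n + 1) by simp [Nat.bit]; ring,
        Nat.bit0_bits _ (by omega), ih,
        show Nat.bit true n = 2 * n + 1 by simp [Nat.bit], Nat.bit1_bits, incBits]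

theorem length_bits_le (n : ℕ) : n.bits.length ≤ n := by
  rw [Nat.size_eq_bits_len]
  exact Nat.size_le.2 n.lt_two_pow_self

/-- States of `onesMachine`. -/
inductive OnesState
  | idle
  | carry
  | back
  deriving DecidableEq

instance : Finite OnesState :=
  Finite.of_surjective ![OnesState.idle, OnesState.carry, OnesState.back]
    fun q => by cases q <;> decide

/-- A machine that writes the number of leading ones of its input in binary. The tape `false` holds
the input, the tape `true` the output. -/
def onesMachine : BitMachine where
  Q := OnesState
  K := Bool
  inTape := false
  start := OnesState.idle
  δ q s := match q with
    | OnesState.idle =>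
      match s false with
      | bit true => Sum.inr (OnesState.carry,
          fun i => if i then (s i, none) else (s i, some Dir.right))
      | _ => Sum.inl true
    | OnesState.carry =>
      match s true with
      | bit true => Sum.inr (OnesState.carry,
          fun i => if i then (bit false, some Dir.right) else (s i, none))
      | _ => Sum.inr (OnesState.back,
          fun i => if i then (bit true, some Dir.left) else (s i, none))
    | OnesState.back =>
      match s true with
      | bit _ => Sum.inr (OnesState.back,
          fun i => if i then (s i, some Dir.left) else (s i, none))
      | _ => Sum.inr (OnesState.idle,
          fun i => if i then (s i, some Dir.right) else (s i, none))

/-- Configurations of `onesMachine`. -/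
def onesCfg (q : OnesState) (T T' : BTape) : onesMachine.Cfg :=
  (q, fun i : Bool => if i then T' else T)

theorem onesMachine_step (q : OnesState) (T T' : BTape) :
    onesMachine.step (onesCfg q T T') = match q with
    | OnesState.idle =>
      match T.head with
      | bit true => onesCfg OnesState.carry (act T (bit true, some Dir.right)) T'
      | _ => onesCfg q T T'
    | OnesState.carry =>
      match T'.head with
      | bit true => onesCfg OnesState.carry T (act T' (bit false, some Dir.right))
      | _ => onesCfg OnesState.back T (act T' (bit true, some Dir.left))
    | OnesState.back =>
      match T'.head with
      | bit _ => onesCfg OnesState.back T (act T' (T'.head, some Dir.left))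
      | _ => onesCfg OnesState.idle T (act T' (T'.head, some Dir.right)) := by
  have h (i : Bool) (T T' : BTape) (w w' : Sym × Option Dir) :
      act (if i then T' else T) (if i then w' else w) = if i then act T' w' else act T w := by
    cases i <;> rfl
  have h' (i : Bool) (T T' : BTape) :
      (if i then T' else T).head = if i then T'.head else T.head := by
    cases i <;> rfl
  cases q
  · rcases e : T.head with _ | (_ | _) | ⟨⟨⟩⟩ <;>
      simp [BitMachine.step, BitMachine.next, onesMachine, onesCfg, e]
    · funext i; cases i <;> simp [e]
  · rcases e : T'.head with _ | (_ | _) | ⟨⟨⟩⟩ <;>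
      simp [BitMachine.step, BitMachine.next, onesMachine, onesCfg, e] <;>
      · funext i; cases i <;> simp
  · rcases e : T'.head with _ | (_ | _) | ⟨⟨⟩⟩ <;>
      simp [BitMachine.step, BitMachine.next, onesMachine, onesCfg, e] <;>
      · funext i; cases i <;> simp [e]

theorem onesMachine_back (T : BTape) (a r : List Bool) :
    Reaches onesMachine.step (onesCfg OnesState.back T (backTape a r)) (a.length + 1)
      (onesCfg OnesState.idle T (bitTape [] (a.reverse ++ r))) := by
  induction a generalizing r with
  | nil => exact Reaches.single (by simp [onesMachine_step])
  | cons b a ih =>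
    refine Reaches.step ?_ (by simpa using ih (b :: r))
    simp [onesMachine_step]

theorem onesMachine_carry (T : BTape) (a r : List Bool) :
    ∃ t ≤ a.length + 2 * r.length + 2,
      Reaches onesMachine.step (onesCfg OnesState.carry T (bitTape a r)) t
        (onesCfg OnesState.idle T (bitTape [] (a.reverse ++ incBits r))) := by
  induction r generalizing a with
  | nil =>
    exact ⟨a.length + 1 + 1, by simp, Reaches.step (by simp [onesMachine_step])
      (onesMachine_back T a [true])⟩
  | cons b r ih =>
    cases b with
    | false =>
      exact ⟨a.length + 1 + 1, by simp, Reaches.step (by simp [onesMachine_step])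
        (onesMachine_back T a (true :: r))⟩
    | true =>
      obtain ⟨t, h1, h2⟩ := ih (false :: a)
      refine ⟨t + 1, by simp only [List.length_cons] at h1 ⊢; omega,
        Reaches.step ?_ (by simpa [incBits] using h2)⟩
      simp [onesMachine_step]

/-- A number has at most as many bits as its value; this crude bound for the width of the counter is
enough for polynomial time. -/
theorem onesMachine_idle (l r : List Bool) (m : ℕ) :
    ∃ t ≤ leadingOnes r * (2 * (m + leadingOnes r) + 3), ∃ T,
      Reaches onesMachine.step (onesCfg OnesState.idle (bitTape l r) (bitTape [] m.bits)) t
        (onesCfg OnesState.idle T (bitTape [] (m + leadingOnes r).bits)) ∧ T.head ≠ bit true := by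
  induction r generalizing l m with
  | nil => exact ⟨0, by simp, _, Reaches.refl _ _, by simp⟩
  | cons b r ih =>
    cases b with
    | false => exact ⟨0, by simp, _, Reaches.refl _ _, by simp⟩
    | true =>
      obtain ⟨t, h1, T, h2, h3⟩ := ih (true :: l) (m + 1)
      obtain ⟨t', h4, h5⟩ := onesMachine_carry (bitTape (true :: l) r) [] m.bits
      rw [List.reverse_nil, List.nil_append, ← bits_succ] at h5
      have h6 := length_bits_le m
      simp only [List.length_nil] at h4
      refine ⟨t' + 1 + t, ?_, T, (Reaches.step ?_ h5).trans ?_, h3⟩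
      · rw [leadingOnes]; nlinarith
      · simp [onesMachine_step]
      · rwa [leadingOnes, ← Nat.add_assoc, Nat.add_right_comm]

/-- The output tape of `onesMachine`. -/
def onesOut : onesMachine.K := true

theorem polyTimeComputable_leadingOnes : PolyTimeComputable leadingOnes := by
  refine ⟨onesMachine.toOracleTM onesOut, onesMachine.oracleFree_toOracleTM onesOut,
    Polynomial.X * (2 * Polynomial.X + 3), fun x => ?_⟩
  obtain ⟨t, h1, T, h2, h3⟩ := onesMachine_idle [] x 0
  have h4 : onesMachine.run x t = onesCfg OnesState.idle T (bitTape [] (leadingOnes x).bits) := by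
    rw [Nat.zero_add] at h2
    rw [← h2]
    refine congrArg onesMachine.step^[t] (Prod.ext rfl (funext fun i : Bool => ?_))
    cases i <;> rfl
  have h5 : onesMachine.verdict (onesMachine.run x t) = some true := by
    rw [h4, BitMachine.verdict_eq_some]
    simp only [BitMachine.next, onesMachine, onesCfg]
    rcases e : T.head with _ | (_ | _) | ⟨⟨⟩⟩ <;> simp_all
  have h6 : t ≤ Polynomial.eval x.length (Polynomial.X * (2 * Polynomial.X + 3)) := by
    have := leadingOnes_le_length x
    simp only [Polynomial.eval_mul, Polynomial.eval_add, Polynomial.eval_X,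
      Polynomial.eval_ofNat]
    refine h1.trans ?_
    gcongr
    omega
  refine ⟨⟨true, BitMachine.haltsWithin_toOracleTM _ (BitMachine.verdict_of_le h5 h6)⟩, ?_⟩
  rw [BitMachine.cfgAt_toOracleTM, BitMachine.run_of_le h5 h6, h4]
  exact tapeBits_bitTape _ _

/-! ### A machine that runs for about `2 ^ k` steps -/

/-- A machine that reads the leading ones of the input, say `k` of them, and then rejects after it
has run through the values of a counter with `k` bits. -/
def clock : BitMachine where
  Q := Option CounterPhase
  K := Bool
  inTape := false
  start := none
  δ q s := match q with
    | none =>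
      match s false with
      | bit true => Sum.inr (none,
          fun i => if i then (bit false, some Dir.right) else (bit true, some Dir.right))
      | _ => Sum.inr (some back,
          fun i => if i then (blank, some Dir.left) else (s i, none))
    | some fresh => Sum.inl false
    | some p => Sum.inr (some (counterδ p (s true)).1,
          fun i => if i then (counterδ p (s true)).2 else (s i, none))

/-- Configurations of `clock`. -/
def clockCfg (q : Option CounterPhase) (T T' : BTape) : clock.Cfg :=
  (q, fun i : Bool => if i then T' else T)

theorem clock_step_counter (T : BTape) (c : CounterPhase × BTape) (hc : c.1 ≠ fresh) :
    clock.step (clockCfg (some c.1) T c.2) =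
      clockCfg (some (counterStep c).1) T (counterStep c).2 := by
  obtain ⟨p, T'⟩ := c
  cases p
  · exact absurd rfl hc
  all_goals
    refine BitMachine.step_eq rfl fun i : Bool => ?_
    cases i <;> simp [clockCfg, counterStep]

theorem clock_quiet {T : BTape} {c c' : CounterPhase × BTape} {t : ℕ} (h : Quiet c t c') :
    Reaches clock.step (clockCfg (some c.1) T c.2) t (clockCfg (some c'.1) T c'.2) := by
  induction h with
  | refl => exact Reaches.refl _ _
  | step hc _ ih => exact Reaches.step (clock_step_counter T _ hc) ih

theorem clock_read (l r : List Bool) (m : ℕ) :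
    ∃ T, Reaches clock.step
      (clockCfg none (bitTape l r) (bitTape (List.replicate m false) [])) (leadingOnes r + 1)
      (clockCfg (some back) T (backTape (List.replicate (m + leadingOnes r) false) [])) := by
  induction r generalizing l m with
  | nil =>
    refine ⟨bitTape l [], Reaches.single (BitMachine.step_eq rfl fun i : Bool => ?_)⟩
    cases i <;> simp [clockCfg, leadingOnes]
  | cons b r ih =>
    cases b with
    | false =>
      refine ⟨bitTape l (false :: r),
        Reaches.single (BitMachine.step_eq rfl fun i : Bool => ?_)⟩
      cases i <;> simp [clockCfg, leadingOnes]
    | true =>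
      obtain ⟨T, h⟩ := ih (true :: l) (m + 1)
      rw [leadingOnes, ← Nat.add_assoc, Nat.add_right_comm m]
      refine ⟨T, Reaches.step (BitMachine.step_eq rfl fun i : Bool => ?_) h⟩
      cases i <;> simp [clockCfg, List.replicate_succ]

theorem clock_verdict_eq_some {q : Option CounterPhase} {T T' : BTape} {b : Bool}
    (h : clock.verdict (clockCfg q T T') = some b) : q = some fresh := by
  rw [BitMachine.verdict_eq_some] at h
  rcases q with _ | p
  · simp only [BitMachine.next, clock, clockCfg] at h
    split at h <;> cases h
  · cases p
    · rfl
    all_goals cases h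

/-- With `k` leading ones, reading them and returning takes `2k + 2` steps, the count itself between
`2^k` and `2^k (2k + 2)`. There is no earlier verdict, since only the phase `fresh` halts and a
quiet run meets it at its end only. -/
theorem clock_spec (x : List Bool) : ∃ T, 2 ^ leadingOnes x ≤ T ∧
    T ≤ 2 ^ leadingOnes x * (2 * leadingOnes x + 2) + 2 * leadingOnes x + 2 ∧
    (∀ s < T, clock.verdict (clock.run x s) = none) ∧
    ∀ s, T ≤ s → clock.verdict (clock.run x s) = some false := by
  classical
  obtain ⟨T₁, h1⟩ := clock_read [] x 0
  have h0 : clock.init x = clockCfg none (bitTape [] x) (bitTape (List.replicate 0 false) []) :=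
    Prod.ext rfl (funext fun i : Bool => by cases i <;> rfl)
  rw [← h0] at h1
  have h2 := clock_quiet (T := T₁) (quiet_back (List.replicate (0 + leadingOnes x) false) [])
  rw [List.reverse_replicate, List.append_nil, List.length_replicate, Nat.zero_add] at h2
  rw [Nat.zero_add] at h1
  have h3 := h1.trans h2
  set k := leadingOnes x with hk
  obtain ⟨t, h4, h5, h6⟩ := quiet_count k
  have h7 : clock.verdict (clock.run x (k + 1 + (k + 1) + t)) = some false := by
    rw [BitMachine.run_add_of_reaches h3 (clock_quiet h6)]
    rfl
  have h8 : ∀ s < t, clock.verdict (clock.run x (k + 1 + (k + 1) + s)) = none := by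
    intro s hs
    rw [BitMachine.run_add_of_reaches h3 (clock_quiet (h6.of_le hs.le))]
    rcases e : clock.verdict _ with _ | b
    · rfl
    · exact absurd (Option.some.inj (clock_verdict_eq_some e)) (h6.iterate.2 s hs)
  have hp := Nat.one_le_two_pow (n := k)
  refine ⟨k + 1 + (k + 1) + t, by omega, by omega, fun s hs => ?_, fun s hs =>
    BitMachine.verdict_of_le h7 hs⟩
  rcases e : clock.verdict (clock.run x s) with _ | b
  · rfl
  -- An early verdict would persist until the last moment before the overflow, where there is none.
  · have := BitMachine.verdict_of_le (t := k + 1 + (k + 1) + (t - 1)) e (by omega)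
    rw [h8 (t - 1) (by omega)] at this
    cases this

/-! ### A sparse set of lengths -/

/-- One step of an automaton with two tapes. One of them holds a counter, and the other one grows
by a zero in every step. On an overflow of the counter they change roles. -/
def growStep (e : (Bool × CounterPhase) × (Bool → BTape)) :
    (Bool × CounterPhase) × (Bool → BTape) :=
  let r := counterδ e.1.2 (e.2 e.1.1).head
  ((if r.1 = fresh then !e.1.1 else e.1.1, r.1),
    fun i => act (e.2 i) (if i = e.1.1 then r.2 else (bit false, some Dir.left)))

/-- A configuration of the automaton, with the counter on tape `m`, and `v` zeros on the other. -/
def growCfg (m : Bool) (c : CounterPhase × BTape) (v : ℕ) :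
    (Bool × CounterPhase) × (Bool → BTape) :=
  ((m, c.1), fun i => if i = m then c.2 else leftOf (List.replicate v false))

/-- The configurations just after the roles have changed. -/
def growFresh (m : Bool) (w v : ℕ) : (Bool × CounterPhase) × (Bool → BTape) :=
  growCfg m (fresh, leftOf (List.replicate w false)) v

theorem growStep_growCfg (m : Bool) (c : CounterPhase × BTape) (v : ℕ) :
    growStep (growCfg m c v) = ((if (counterStep c).1 = fresh then !m else m, (counterStep c).1),
      fun i => if i = m then (counterStep c).2 else leftOf (List.replicate (v + 1) false)) := by
  simp only [growStep, growCfg, if_true]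
  refine Prod.ext rfl (funext fun i => ?_)
  by_cases hi : i = m <;> simp [hi, counterStep, List.replicate_succ]

theorem growStep_iterate (m : Bool) {c c' : CounterPhase × BTape} {t : ℕ} (h : Quiet c t c')
    (hc : c.1 ≠ fresh) (hc' : c'.1 = fresh) (v : ℕ) :
    growStep^[t] (growCfg m c v) = ((!m, fresh),
      fun i => if i = m then c'.2 else leftOf (List.replicate (v + t) false)) ∧
    ∀ s < t, (growStep^[s] (growCfg m c v)).1.2 ≠ fresh := by
  induction h generalizing v with
  | refl => exact absurd hc' hc
  | @step c c' t hc1 h ih =>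
    simp only [Function.iterate_succ_apply, growStep_growCfg]
    by_cases hd : (counterStep c).1 = fresh
    · cases h with
      | step hc2 => exact absurd hd hc2
      | refl =>
        refine ⟨by simp [hd], fun s hs => ?_⟩
        obtain rfl : s = 0 := by omega
        exact hc
    · have h1 := ih hd hc' (v + 1)
      rw [growCfg] at h1
      simp only [if_neg hd]
      refine ⟨by rw [h1.1, Nat.add_right_comm, Nat.add_assoc], fun s hs => ?_⟩
      cases s with
      | zero => exact hc
      | succ s =>
        rw [Function.iterate_succ_apply, growStep_growCfg, if_neg hd]
        exact h1.2 s (by omega)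

/-- Each step of the count adds a zero to the other tape. The overflow leaves zeros on the counter
tape, with the head on the blank to their left; this is the form of a growing tape, so the roles can
be exchanged at once. -/
theorem growFresh_round (m : Bool) (w v : ℕ) : ∃ t, 2 ^ w ≤ t ∧
    growStep^[t] (growFresh m w v) = growFresh (!m) (v + t) w ∧
    ∀ s, 0 < s → s < t → (growStep^[s] (growFresh m w v)).1.2 ≠ fresh := by
  obtain ⟨t, h1, -, h2⟩ := quiet_count w
  have h3 := growStep_iterate m h2 (by simp) rfl (v + 1)
  have h4 : growStep (growFresh m w v) =
      growCfg m (carry, bitTape [] (List.replicate w false)) (v + 1) := by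
    rw [growFresh, growStep_growCfg]
    simp [counterStep, counterδ, growCfg]
  refine ⟨t + 1, by omega, ?_, fun s h0 hs => ?_⟩
  · rw [Function.iterate_succ_apply, h4, h3.1]
    refine Prod.ext rfl (funext fun i => ?_)
    rw [show v + 1 + t = v + (t + 1) by omega]
    cases i <;> cases m <;> simp [growFresh, growCfg]
  · obtain ⟨s, rfl⟩ := Nat.exists_eq_add_one_of_ne_zero h0.ne'
    rw [Function.iterate_succ_apply, h4]
    exact h3.2 s (by omega)

/-- The configuration of the automaton at time `t`. -/
def growAt (t : ℕ) : (Bool × CounterPhase) × (Bool → BTape) :=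
  growStep^[t] (growFresh false 0 0)

/-- The times at which the roles of the tapes have just changed back. -/
def sparseSet : Set ℕ := {t | (growAt t).1 = (false, fresh)}

/-- Two rounds lead to the next element: the first one makes a counter of width at least `2^w`, and
the second one runs through its values. Every step adds one zero, so the two widths always sum to
the time. In between, the automaton is fresh only once, with exchanged roles. -/
theorem sparseSet_next {a w v : ℕ} (h : growAt a = growFresh false w v) (hwv : w + v = a) :
    ∃ b w' v', growAt b = growFresh false w' v' ∧ w' + v' = b ∧ v' ≤ w' ∧
      a < b ∧ 2 ^ 2 ^ w ≤ b ∧ ∀ s ∈ sparseSet, s < b → s ≤ a := by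
  obtain ⟨t₁, h1, h2, h3⟩ := growFresh_round false w v
  obtain ⟨t₂, h4, h5, h6⟩ := growFresh_round true (v + t₁) w
  have h7 (s : ℕ) : growAt (a + s) = growStep^[s] (growFresh false w v) := by
    rw [← h, growAt, growAt, ← Function.iterate_add_apply, Nat.add_comm]
  have h8 (s : ℕ) : growAt (a + t₁ + s) = growStep^[s] (growFresh true (v + t₁) w) := by
    rw [Nat.add_assoc, h7, Nat.add_comm t₁, Function.iterate_add_apply, h2]
    rfl
  have h9 : 2 ^ 2 ^ w ≤ t₂ := (Nat.pow_le_pow_right (by norm_num) (by omega)).trans h4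
  have h10 := (v + t₁).lt_two_pow_self
  refine ⟨a + t₁ + t₂, w + t₂, v + t₁, by rw [h8, h5]; rfl, by omega, by omega, by omega,
    by omega, fun s hs hsb => ?_⟩
  by_contra! hsa
  obtain ⟨s, rfl⟩ := Nat.exists_eq_add_of_lt hsa
  change (growAt _).1 = _ at hs
  rcases lt_trichotomy (s + 1) t₁ with h11 | h11 | h11
  · refine h3 (s + 1) (by omega) h11 ?_
    rw [← h7, ← Nat.add_assoc, hs]
  · rw [Nat.add_assoc, h11, ← Nat.add_zero (a + t₁), h8] at hs
    simp [growFresh, growCfg] at hs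
  · refine h6 (s + 1 - t₁) (by omega) (by omega) ?_
    rw [← h8, show a + t₁ + (s + 1 - t₁) = a + s + 1 by omega, hs]

theorem exists_sparseSet_large (N : ℕ) : ∃ a w v, N ≤ a ∧ growAt a = growFresh false w v ∧
    w + v = a ∧ v ≤ w := by
  induction N with
  | zero => exact ⟨0, 0, 0, le_rfl, rfl, rfl, le_rfl⟩
  | succ N ih =>
    obtain ⟨a, w, v, h1, h2, h3, -⟩ := ih
    obtain ⟨b, w', v', h5, h6, h7, h8, -⟩ := sparseSet_next h2 h3
    exact ⟨b, w', v', by omega, h5, h6, h7⟩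

/-- For `w ≥ 3 * c + 4`, `c * (2 * w + 1) ≤ w ^ 2`, and `w ^ 2 ≤ 2 ^ w` holds from `4` on. -/
theorem mul_le_two_pow {c w : ℕ} (h : 3 * c + 4 ≤ w) : c * (2 * w + 1) ≤ 2 ^ w := by
  have h1 : ∀ n : ℕ, (n + 4) ^ 2 ≤ 2 ^ (n + 4) := by
    intro n
    induction n with
    | zero => norm_num
    | succ n ih =>
      calc (n + 1 + 4) ^ 2 ≤ (n + 1 + 4) ^ 2 + (n ^ 2 + 6 * n + 7) := by omega
        _ = (n + 4) ^ 2 * 2 := by ring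
        _ ≤ 2 ^ (n + 4) * 2 := by gcongr
        _ = 2 ^ (n + 1 + 4) := by ring
  have h2 := h1 (w - 4)
  rw [Nat.sub_add_cancel (by omega)] at h2
  nlinarith

/-- The gaps of `sparseSet` are more than exponential. -/
theorem sparseSet_gap (c N : ℕ) : ∃ m n, N ≤ n ∧ n ∈ sparseSet ∧
    (∀ s ∈ sparseSet, s < n → s ≤ m) ∧ 2 ^ (c * (m + 1)) ≤ n := by
  -- From `w + v = a` and `v ≤ w` follows `c * (a + 1) ≤ c * (2 * w + 1) ≤ 2 ^ w`, and the next
  -- element is at least `2 ^ 2 ^ w`. The summand `2 * (3 * c + 4)` makes `w` large enough for the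
  -- second inequality.
  obtain ⟨a, w, v, h1, h2, h3, h4⟩ := exists_sparseSet_large (N + 2 * (3 * c + 4))
  obtain ⟨b, w', v', h5, h6, h7, h8, h9, h10⟩ := sparseSet_next h2 h3
  refine ⟨a, b, by omega, by change (growAt _).1 = _; rw [h5]; rfl, h10, le_trans ?_ h9⟩
  refine Nat.pow_le_pow_right (by norm_num) (le_trans ?_ (mul_le_two_pow (c := c) (by omega)))
  gcongr
  omega

/-- A machine that accepts the inputs with length in `sparseSet`. -/
def lengthMachine : BitMachine where
  Q := Bool × CounterPhase
  K := Option Bool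
  inTape := none
  start := (false, fresh)
  δ q s := match s none with
    | bit b =>
      let r := counterδ q.2 (s (some q.1))
      Sum.inr ((if r.1 = fresh then !q.1 else q.1, r.1), fun i => match i with
        | none => (bit b, some Dir.right)
        | some i => if i = q.1 then r.2 else (bit false, some Dir.left))
    | _ => Sum.inl (q == (false, fresh))

/-- Configurations of `lengthMachine`. -/
def lengthCfg (e : (Bool × CounterPhase) × (Bool → BTape)) (T : BTape) : lengthMachine.Cfg :=
  (e.1, fun i : Option Bool => match i with
    | none => T
    | some i => e.2 i)

theorem lengthMachine_read (l r : List Bool) (e : (Bool × CounterPhase) × (Bool → BTape)) :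
    ∃ T, T.head = blank ∧ Reaches lengthMachine.step (lengthCfg e (bitTape l r)) r.length
      (lengthCfg (growStep^[r.length] e) T) := by
  induction r generalizing l e with
  | nil => exact ⟨_, rfl, Reaches.refl _ _⟩
  | cons b r ih =>
    obtain ⟨T, h1, h2⟩ := ih (b :: l) (growStep e)
    refine ⟨T, h1, Reaches.step (BitMachine.step_eq rfl fun i : Option Bool => ?_) h2⟩
    rcases i with _ | i
    · simp [lengthCfg]
    · rfl

open Classical in
-- The automaton makes one step per input symbol, so its time is the length of the input, and
-- membership in `sparseSet` is known when the input has been read.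
theorem lengthMachine_spec (x : List Bool) :
    lengthMachine.verdict (lengthMachine.run x x.length) = some (decide (x.length ∈ sparseSet)) := by
  obtain ⟨T, h1, h2⟩ := lengthMachine_read [] x (growFresh false 0 0)
  have h0 : lengthMachine.init x = lengthCfg (growFresh false 0 0) (bitTape [] x) := by
    refine Prod.ext rfl (funext fun i : Option Bool => ?_)
    rcases i with _ | _ | _ <;> simp [BitMachine.init, lengthMachine, lengthCfg, growFresh, growCfg,
      leftOf_nil]
  rw [← h0] at h2
  rw [BitMachine.run, h2, BitMachine.verdict_eq_some]
  simp only [BitMachine.next, lengthCfg, lengthMachine, h1]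
  rw [show growStep^[x.length] (growFresh false 0 0) = growAt x.length from rfl]
  congr 1
  rw [Bool.eq_iff_iff, beq_iff_eq, decide_eq_true_iff]
  rfl

/-! ### A universal machine for a simple rewriting system

A program is a list of records `(o, w)`, and the data is a word. In one step, the data
`1 ^ m 0 d` is replaced by `1 ^ o d w`, where `(o, w)` is the record with index `m`. If there is no
such record, the machine accepts. -/

/-- States of `universal`. -/
inductive UState
  | read (f : Bool)
  | zero (f : Bool)
  | endOne
  | endZero
  | rewind
  | pop
  | skip
  | skipOffset
  | skipWord
  | skipBit
  | exec
  | offset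
  | toEnd
  | append
  | appendBit
  deriving DecidableEq

instance : Finite UState :=
  Finite.of_surjective ![UState.read false, UState.read true, UState.zero false, UState.zero true,
    UState.endOne, UState.endZero, UState.rewind, UState.pop, UState.skip, UState.skipOffset,
    UState.skipWord, UState.skipBit, UState.exec, UState.offset, UState.toEnd, UState.append,
    UState.appendBit] fun q => by
      rcases q with ⟨_ | _⟩ | ⟨_ | _⟩ | _ | _ | _ | _ | _ | _ | _ | _ | _ | _ | _ | _ | _ <;> decide

/-- Tapes of `universal`. -/
inductive UTape
  | input
  | prog
  | data
  deriving DecidableEq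

instance : Finite UTape :=
  Finite.of_surjective ![UTape.input, UTape.prog, UTape.data] fun q => by cases q <;> decide

/-- A family indexed by the tapes of `universal`. -/
def onUTapes {β : Type*} (a b c : β) : UTape → β
  | UTape.input => a
  | UTape.prog => b
  | UTape.data => c

/-- The universal machine. On an input `1 ^ k 0 p`, it runs the program `p` on an encoding of the
whole input. -/
def universal : BitMachine where
  Q := UState
  K := UTape
  inTape := UTape.input
  start := UState.read false
  δ q s :=
    let i := s UTape.input
    let p := s UTape.prog
    let d := s UTape.data
    match q with
    | UState.read f =>
      match i with
      | bit b => Sum.inr (if b then UState.zero f else UState.read true,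
          onUTapes (bit b, some Dir.right) (if f then (bit b, some Dir.right) else (p, none))
            (bit b, some Dir.right))
      | _ => Sum.inr (UState.endOne, onUTapes (i, none) (p, none) (bit true, some Dir.right))
    | UState.zero f => Sum.inr (UState.read f,
        onUTapes (i, none) (p, none) (bit false, some Dir.right))
    | UState.endOne => Sum.inr (UState.endZero,
        onUTapes (i, none) (p, none) (bit true, some Dir.right))
    | UState.endZero => Sum.inr (UState.rewind,
        onUTapes (i, none) (p, some Dir.left) (bit false, some Dir.left))
    | UState.rewind =>
      match p, d with
      | bit _, bit _ => Sum.inr (UState.rewind,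
          onUTapes (i, none) (p, some Dir.left) (d, some Dir.left))
      | bit _, _ => Sum.inr (UState.rewind,
          onUTapes (i, none) (p, some Dir.left) (d, none))
      | _, bit _ => Sum.inr (UState.rewind,
          onUTapes (i, none) (p, none) (d, some Dir.left))
      | _, _ => Sum.inr (UState.pop,
          onUTapes (i, none) (p, some Dir.right) (d, some Dir.right))
    | UState.pop =>
      match d with
      | bit b => Sum.inr (if b then UState.skip else UState.exec,
          onUTapes (i, none) (p, none) (blank, some Dir.right))
      | _ => Sum.inl false
    | UState.skip =>
      match p with
      | bit true => Sum.inr (UState.skipOffset,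
          onUTapes (i, none) (p, some Dir.right) (d, none))
      | _ => Sum.inl true
    | UState.skipOffset =>
      match p with
      | bit b => Sum.inr (if b then UState.skipOffset else UState.skipWord,
          onUTapes (i, none) (p, some Dir.right) (d, none))
      | _ => Sum.inl false
    | UState.skipWord =>
      match p with
      | bit b => Sum.inr (if b then UState.skipBit else UState.pop,
          onUTapes (i, none) (p, some Dir.right) (d, none))
      | _ => Sum.inl false
    | UState.skipBit => Sum.inr (UState.skipWord,
        onUTapes (i, none) (p, some Dir.right) (d, none))
    | UState.exec =>
      match p with
      | bit true => Sum.inr (UState.offset,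
          onUTapes (i, none) (p, some Dir.right) (d, some Dir.left))
      | _ => Sum.inl true
    | UState.offset =>
      match p with
      | bit b => Sum.inr (if b then UState.offset else UState.toEnd,
          onUTapes (i, none) (p, some Dir.right)
            (if b then (bit true, some Dir.left) else (d, some Dir.right)))
      | _ => Sum.inl false
    | UState.toEnd =>
      match d with
      | bit b => Sum.inr (UState.toEnd,
          onUTapes (i, none) (p, none) (bit b, some Dir.right))
      | _ => Sum.inr (UState.append, onUTapes (i, none) (p, none) (d, none))
    | UState.append =>
      match p with
      | bit true => Sum.inr (UState.appendBit,
          onUTapes (i, none) (p, some Dir.right) (d, none))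
      | _ => Sum.inr (UState.rewind,
          onUTapes (i, none) (p, some Dir.left) (d, some Dir.left))
    | UState.appendBit =>
      match p with
      | bit b => Sum.inr (UState.append,
          onUTapes (i, none) (p, some Dir.right) (bit b, some Dir.right))
      | _ => Sum.inl false

/-- Configurations of `universal`. -/
def uCfg (q : UState) (I P D : BTape) : universal.Cfg := (q, onUTapes I P D)

/-- The pairs `1 c` for the bits `c` of a word. -/
def markBits (w : List Bool) : List Bool := w.flatMap fun c => [true, c]

@[simp] theorem markBits_nil : markBits [] = [] := rfl

@[simp] theorem markBits_cons (c : Bool) (w : List Bool) :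
    markBits (c :: w) = true :: c :: markBits w := rfl

theorem length_markBits (w : List Bool) : (markBits w).length = 2 * w.length := by
  induction w with
  | nil => rfl
  | cons c w ih => simp [ih]; ring

/-- The encoding of a record. -/
def encRecord (r : ℕ × List Bool) : List Bool :=
  true :: (List.replicate r.1 true ++ false :: (markBits r.2 ++ [false]))

theorem length_encRecord (r : ℕ × List Bool) :
    (encRecord r).length = r.1 + 2 * r.2.length + 3 := by
  simp [encRecord, length_markBits]; ring

/-- The encoding of a program. -/
def encProgram (recs : List (ℕ × List Bool)) : List Bool := recs.flatMap encRecord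

/-! ### Runs of the universal machine. -/

theorem u_skipOffset (I D : BTape) (a r : List Bool) (o : ℕ) :
    ∃ a', a'.reverse ++ r = a.reverse ++ (List.replicate o true ++ false :: r) ∧
      Reaches universal.step
        (uCfg UState.skipOffset I (bitTape a (List.replicate o true ++ false :: r)) D) (o + 1)
        (uCfg UState.skipWord I (bitTape a' r) D) := by
  induction o generalizing a with
  | zero =>
    refine ⟨false :: a, by simp, Reaches.single (BitMachine.step_eq rfl fun i : UTape => ?_)⟩
    cases i <;> simp [uCfg, onUTapes]
  | succ o ih =>
    obtain ⟨a', h1, h2⟩ := ih (true :: a)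
    refine ⟨a', by simp [h1, List.replicate_succ],
      Reaches.step (BitMachine.step_eq rfl fun i : UTape => ?_) h2⟩
    cases i <;> simp [uCfg, onUTapes, List.replicate_succ]

theorem u_skipWord (I D : BTape) (a r w : List Bool) :
    ∃ a', a'.reverse ++ r = a.reverse ++ (markBits w ++ false :: r) ∧
      Reaches universal.step (uCfg UState.skipWord I (bitTape a (markBits w ++ false :: r)) D)
        (2 * w.length + 1) (uCfg UState.pop I (bitTape a' r) D) := by
  induction w generalizing a with
  | nil =>
    refine ⟨false :: a, by simp, Reaches.single (BitMachine.step_eq rfl fun i : UTape => ?_)⟩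
    cases i <;> simp [uCfg, onUTapes]
  | cons c w ih =>
    obtain ⟨a', h1, h2⟩ := ih (c :: true :: a)
    refine ⟨a', by simp [h1], Reaches.step (b := uCfg UState.skipBit I
        (bitTape (true :: a) (c :: (markBits w ++ false :: r))) D)
      (BitMachine.step_eq rfl fun i : UTape => ?_)
      (Reaches.step (BitMachine.step_eq rfl fun i : UTape => ?_) h2)⟩
    all_goals cases i <;> simp [uCfg, onUTapes]

theorem u_skip (I D : BTape) (a r : List Bool) (e : ℕ × List Bool) :
    ∃ a', a'.reverse ++ r = a.reverse ++ (encRecord e ++ r) ∧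
      Reaches universal.step (uCfg UState.skip I (bitTape a (encRecord e ++ r)) D)
        (encRecord e).length (uCfg UState.pop I (bitTape a' r) D) := by
  obtain ⟨a₁, h1, h2⟩ := u_skipOffset I D (true :: a) (markBits e.2 ++ false :: r) e.1
  obtain ⟨a₂, h3, h4⟩ := u_skipWord I D a₁ r e.2
  refine ⟨a₂, by simp [h3, h1, encRecord], ?_⟩
  rw [length_encRecord, show e.1 + 2 * e.2.length + 3 = e.1 + 1 + (2 * e.2.length + 1) + 1 by ring]
  refine Reaches.step (BitMachine.step_eq rfl fun i : UTape => ?_) (h2.trans h4)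
  cases i <;> simp [uCfg, onUTapes, encRecord]

/-- Every one that is erased from the data skips one record, at the cost of its length plus one. -/
theorem u_pop (I : BTape) (a pad d : List Bool) (recs : List (ℕ × List Bool)) (m : ℕ)
    (hm : m < recs.length) :
    ∃ a' t, a'.reverse ++ (encProgram (recs.drop m) ++ pad) =
        a.reverse ++ (encProgram recs ++ pad) ∧
      1 ≤ t ∧ t ≤ 2 * (encProgram recs).length + 1 ∧
      Reaches universal.step (uCfg UState.pop I (bitTape a (encProgram recs ++ pad))
        (bitTape [] (List.replicate m true ++ false :: d))) t
        (uCfg UState.exec I (bitTape a' (encProgram (recs.drop m) ++ pad)) (bitTape [] d)) := by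
  induction m generalizing recs a with
  | zero =>
    refine ⟨a, 1, rfl, le_rfl, by omega,
      Reaches.single (BitMachine.step_eq rfl fun i : UTape => ?_)⟩
    cases i <;> simp [uCfg, onUTapes]
  | succ m ih =>
    cases recs with
    | nil => simp at hm
    | cons e recs =>
      obtain ⟨a₁, h1, h2⟩ := u_skip I (bitTape [] (List.replicate m true ++ false :: d)) a
        (encProgram recs ++ pad) e
      obtain ⟨a₂, t, h3, -, h4, h5⟩ := ih a₁ recs (by simpa using hm)
      have h6 : encProgram (e :: recs) = encRecord e ++ encProgram recs := rfl
      have h7 := length_encRecord e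
      refine ⟨a₂, (encRecord e).length + 1 + t, by simp [h3, h1, h6], by omega, ?_,
        (Reaches.step (BitMachine.step_eq rfl fun i : UTape => ?_) h2).trans h5⟩
      · rw [h6, List.length_append]; omega
      · cases i <;> simp [uCfg, onUTapes, h6, List.replicate_succ]

theorem verdict_skip {I P D : BTape} (h : P.head ≠ bit true) :
    universal.verdict (uCfg UState.skip I P D) = some true := by
  rw [BitMachine.verdict_eq_some]
  simp only [BitMachine.next, uCfg, universal, onUTapes]

theorem verdict_exec {I P D : BTape} (h : P.head ≠ bit true) :
    universal.verdict (uCfg UState.exec I P D) = some true := by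
  rw [BitMachine.verdict_eq_some]
  simp only [BitMachine.next, uCfg, universal, onUTapes]

/-- Every record begins with a one, so a zero of the padding or a blank shows that there are no more
records. -/
theorem bitTape_head_ne {a pad : List Bool} (h : pad.head? ≠ some true) :
    (bitTape a pad).head ≠ bit true := by
  rcases pad with _ | ⟨_ | _, pad⟩ <;> simp_all

/-- The universal machine accepts if there is no record with the index in question. -/
theorem u_accept (I : BTape) (a pad d : List Bool) (hpad : pad.head? ≠ some true)
    (recs : List (ℕ × List Bool)) (m : ℕ) (hm : recs.length ≤ m) :
    ∃ t c, t ≤ 2 * (encProgram recs).length + 1 ∧ universal.verdict c = some true ∧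
      Reaches universal.step (uCfg UState.pop I (bitTape a (encProgram recs ++ pad))
        (bitTape [] (List.replicate m true ++ false :: d))) t c := by
  induction m generalizing recs a with
  | zero =>
    obtain rfl : recs = [] := List.eq_nil_of_length_eq_zero (by omega)
    refine ⟨1, _, by omega, verdict_exec (P := bitTape a pad) (I := I) (D := bitTape [] d)
      (bitTape_head_ne hpad),
      Reaches.single (BitMachine.step_eq rfl fun i : UTape => ?_)⟩
    cases i <;> simp [uCfg, onUTapes, encProgram]
  | succ m ih =>
    cases recs with
    | nil =>
      refine ⟨1, _, by omega, verdict_skip (P := bitTape a pad) (I := I)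
        (D := bitTape [] (List.replicate m true ++ false :: d)) (bitTape_head_ne hpad),
        Reaches.single (BitMachine.step_eq rfl fun i : UTape => ?_)⟩
      cases i <;> simp [uCfg, onUTapes, encProgram, List.replicate_succ]
    | cons e recs =>
      obtain ⟨a₁, h1, h2⟩ := u_skip I (bitTape [] (List.replicate m true ++ false :: d)) a
        (encProgram recs ++ pad) e
      obtain ⟨t, c, h3, h4, h5⟩ := ih a₁ recs (by simpa using hm)
      have h6 : encProgram (e :: recs) = encRecord e ++ encProgram recs := rfl
      have h7 := length_encRecord e
      refine ⟨(encRecord e).length + 1 + t, c, ?_, h4,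
        (Reaches.step (BitMachine.step_eq rfl fun i : UTape => ?_) h2).trans h5⟩
      · rw [h6, List.length_append]; omega
      · cases i <;> simp [uCfg, onUTapes, h6, List.replicate_succ]

/-- Popping has blanked the cells to the left of the data, so the new prefix can be written there,
from right to left. -/
theorem u_offset (I : BTape) (a r d : List Bool) (o : ℕ) :
    ∃ a', a'.reverse ++ r = a.reverse ++ (List.replicate o true ++ false :: r) ∧
      Reaches universal.step
        (uCfg UState.offset I (bitTape a (List.replicate o true ++ false :: r)) (leftOf d)) (o + 1)
        (uCfg UState.toEnd I (bitTape a' r) (bitTape [] (List.replicate o true ++ d))) := by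
  induction o generalizing a d with
  | zero =>
    refine ⟨false :: a, by simp, Reaches.single (BitMachine.step_eq rfl fun i : UTape => ?_)⟩
    cases i <;> simp [uCfg, onUTapes]
  | succ o ih =>
    obtain ⟨a', h1, h2⟩ := ih (true :: a) (true :: d)
    rw [show List.replicate o true ++ true :: d = List.replicate (o + 1) true ++ d by
      simp [List.replicate_succ']] at h2
    refine ⟨a', by simp [h1, List.replicate_succ],
      Reaches.step (BitMachine.step_eq rfl fun i : UTape => ?_) h2⟩
    cases i <;> simp [uCfg, onUTapes, List.replicate_succ]

theorem u_toEnd (I P : BTape) (l r : List Bool) :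
    Reaches universal.step (uCfg UState.toEnd I P (bitTape l r)) (r.length + 1)
      (uCfg UState.append I P (bitTape (r.reverse ++ l) [])) := by
  induction r generalizing l with
  | nil =>
    refine Reaches.single (BitMachine.step_eq rfl fun i : UTape => ?_)
    cases i <;> simp [uCfg, onUTapes]
  | cons b r ih =>
    have h := ih (b :: l)
    refine Reaches.step (BitMachine.step_eq rfl fun i : UTape => ?_) (by simpa using h)
    cases i <;> simp [uCfg, onUTapes]

theorem u_append (I : BTape) (a r l w : List Bool) :
    ∃ a', a'.reverse ++ false :: r = a.reverse ++ (markBits w ++ false :: r) ∧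
      Reaches universal.step
        (uCfg UState.append I (bitTape a (markBits w ++ false :: r)) (bitTape l []))
        (2 * w.length + 1)
        (uCfg UState.rewind I (backTape a' (false :: r)) (backTape (w.reverse ++ l) [])) := by
  induction w generalizing a l with
  | nil =>
    refine ⟨a, by simp, Reaches.single (BitMachine.step_eq rfl fun i : UTape => ?_)⟩
    cases i <;> simp [uCfg, onUTapes]
  | cons c w ih =>
    obtain ⟨a', h1, h2⟩ := ih (c :: true :: a) (c :: l)
    rw [show w.reverse ++ c :: l = (c :: w).reverse ++ l by simp] at h2
    refine ⟨a', by simp [h1], Reaches.step (b := uCfg UState.appendBit I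
        (bitTape (true :: a) (c :: (markBits w ++ false :: r))) (bitTape l []))
      (BitMachine.step_eq rfl fun i : UTape => ?_)
      (Reaches.step (BitMachine.step_eq rfl fun i : UTape => ?_) h2)⟩
    all_goals cases i <;> simp [uCfg, onUTapes]

theorem u_rewind (I : BTape) (a r a' r' : List Bool) :
    ∃ t ≤ a.length + a'.length + 1,
      Reaches universal.step (uCfg UState.rewind I (backTape a r) (backTape a' r')) t
        (uCfg UState.pop I (bitTape [] (a.reverse ++ r)) (bitTape [] (a'.reverse ++ r'))) := by
  induction a generalizing r a' r' with
  | nil =>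
    induction a' generalizing r' with
    | nil =>
      refine ⟨1, by simp, Reaches.single (BitMachine.step_eq rfl fun i : UTape => ?_)⟩
      cases i <;> simp [uCfg, onUTapes]
    | cons b a' ih =>
      obtain ⟨t, h1, h2⟩ := ih (b :: r')
      refine ⟨t + 1, by simpa using h1,
        Reaches.step (BitMachine.step_eq rfl fun i : UTape => ?_) (by simpa using h2)⟩
      cases i <;> simp [uCfg, onUTapes]
  | cons c a ih =>
    cases a' with
    | nil =>
      obtain ⟨t, h1, h2⟩ := ih (c :: r) [] r'
      refine ⟨t + 1, by simpa using h1,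
        Reaches.step (b := uCfg UState.rewind I (backTape a (c :: r)) (backTape [] r'))
          (BitMachine.step_eq rfl fun i : UTape => ?_) (by simpa using h2)⟩
      cases i <;> simp [uCfg, onUTapes]
    | cons b a' =>
      obtain ⟨t, h1, h2⟩ := ih (c :: r) a' (b :: r')
      refine ⟨t + 1, by simp only [List.length_cons]; omega,
        Reaches.step (BitMachine.step_eq rfl fun i : UTape => ?_) (by simpa using h2)⟩
      cases i <;> simp [uCfg, onUTapes]

theorem u_exec (I : BTape) (a r d : List Bool) (e : ℕ × List Bool) :
    ∃ t ≤ 4 * (a.reverse ++ (encRecord e ++ r)).length + 2 * d.length + 10,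
      Reaches universal.step (uCfg UState.exec I (bitTape a (encRecord e ++ r)) (bitTape [] d)) t
        (uCfg UState.pop I (bitTape [] (a.reverse ++ (encRecord e ++ r)))
          (bitTape [] (List.replicate e.1 true ++ d ++ e.2))) := by
  obtain ⟨a₁, h1, h2⟩ := u_offset I (true :: a) (markBits e.2 ++ false :: r) d e.1
  have h3 := u_toEnd I (bitTape a₁ (markBits e.2 ++ false :: r)) []
    (List.replicate e.1 true ++ d)
  obtain ⟨a₂, h4, h5⟩ := u_append I a₁ r ((List.replicate e.1 true ++ d).reverse ++ []) e.2
  obtain ⟨t, h6, h7⟩ := u_rewind I a₂ (false :: r)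
    (e.2.reverse ++ ((List.replicate e.1 true ++ d).reverse ++ [])) []
  have h8 : a₂.reverse ++ false :: r = a.reverse ++ (encRecord e ++ r) := by
    rw [h4, h1]; simp [encRecord]
  rw [h8] at h7
  have hd : (e.2.reverse ++ ((List.replicate e.1 true ++ d).reverse ++ [])).reverse ++
      ([] : List Bool) = List.replicate e.1 true ++ d ++ e.2 := by simp
  rw [hd] at h7
  have h9 := Reaches.step (a := uCfg UState.exec I (bitTape a (encRecord e ++ r)) (bitTape [] d))
    (BitMachine.step_eq rfl fun i : UTape => by
      cases i
      · simp [uCfg, onUTapes]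
      · simp [uCfg, onUTapes, encRecord]
      · exact act_head_left d) h2
  refine ⟨_, ?_, ((h9.trans h3).trans h5).trans h7⟩
  have h10 := congrArg List.length h8
  simp only [List.length_append, List.length_reverse, List.length_cons, length_encRecord,
    List.length_replicate, List.length_nil] at h6 h10 ⊢
  omega

/-- One step of the rewriting system is simulated in linear time. -/
theorem u_step (I : BTape) (pad d : List Bool) (recs : List (ℕ × List Bool)) (m : ℕ)
    (hm : m < recs.length) :
    ∃ t, 1 ≤ t ∧ t ≤ 6 * (encProgram recs ++ pad).length + 2 * d.length + 11 ∧
      Reaches universal.step (uCfg UState.pop I (bitTape [] (encProgram recs ++ pad))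
        (bitTape [] (List.replicate m true ++ false :: d))) t
        (uCfg UState.pop I (bitTape [] (encProgram recs ++ pad))
          (bitTape [] (List.replicate recs[m].1 true ++ d ++ recs[m].2))) := by
  obtain ⟨a, t, h1, h2, h3, h4⟩ := u_pop I [] pad d recs m hm
  have h5 : encProgram (recs.drop m) ++ pad =
      encRecord recs[m] ++ (encProgram (recs.drop (m + 1)) ++ pad) := by
    rw [List.drop_eq_getElem_cons hm, ← List.append_assoc]
    rfl
  rw [h5] at h1 h4
  obtain ⟨t', h6, h7⟩ := u_exec I a (encProgram (recs.drop (m + 1)) ++ pad) d recs[m]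
  rw [h1, List.reverse_nil, List.nil_append] at h6 h7
  refine ⟨t + t', by omega, ?_, h4.trans h7⟩
  rw [List.length_append] at h6 ⊢
  omega

/-- The part of a word after the first zero; or all of it if `f`. -/
def programPart : Bool → List Bool → List Bool
  | true, x => x
  | false, [] => []
  | false, true :: x => programPart false x
  | false, false :: x => x

theorem programPart_replicate_append (k : ℕ) (l : List Bool) :
    programPart false (List.replicate k true ++ false :: l) = l := by
  induction k with
  | zero => rfl
  | succ k ih => simpa [List.replicate_succ, programPart] using ih

/-- The encoding of an input as data. -/
def encInput (x : List Bool) : List Bool := x.flatMap fun b => if b then [true, false] else [false]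

/-- The whole input, program included, becomes data: `0`, `10` and `110` are the unary codes of the
letters `0`, `1`, `2`, which stand for the two bits and the end of the input. The flag `f` tells
whether the first zero has been passed; from there on the input is also copied as the program. -/
theorem u_read (l x a b : List Bool) (f : Bool) :
    ∃ I, ∃ t ≤ 2 * x.length + 3,
      Reaches universal.step (uCfg (UState.read f) (bitTape l x) (bitTape a []) (bitTape b [])) t
        (uCfg UState.rewind I (backTape ((programPart f x).reverse ++ a) [])
          (backTape (true :: true :: ((encInput x).reverse ++ b)) [false])) := by
  induction x generalizing l a b f with
  | nil =>
    refine ⟨bitTape l [], 3, by simp, ?_⟩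
    refine Reaches.step (b := uCfg UState.endOne (bitTape l []) (bitTape a [])
      (bitTape (true :: b) [])) (BitMachine.step_eq rfl fun i : UTape => ?_) ?_
    · cases i <;> simp [uCfg, onUTapes]
    refine Reaches.step (b := uCfg UState.endZero (bitTape l []) (bitTape a [])
      (bitTape (true :: true :: b) [])) (BitMachine.step_eq rfl fun i : UTape => ?_) ?_
    · cases i <;> simp [uCfg, onUTapes]
    refine Reaches.single (BitMachine.step_eq rfl fun i : UTape => ?_)
    have h : programPart f [] = [] := by cases f <;> rfl
    cases i <;> simp [uCfg, onUTapes, h, encInput]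
  | cons c x ih =>
    cases c with
    | false =>
      obtain ⟨I, t, h1, h2⟩ := ih (false :: l) (if f then false :: a else a) (false :: b) true
      refine ⟨I, t + 1, by simp only [List.length_cons]; omega,
        Reaches.step (b := uCfg (UState.read true) (bitTape (false :: l) x)
          (bitTape (if f then false :: a else a) []) (bitTape (false :: b) []))
          (BitMachine.step_eq rfl fun i : UTape => ?_) ?_⟩
      · cases i <;> cases f <;> simp [uCfg, onUTapes]
      · cases f <;> simpa [programPart, encInput] using h2
    | true =>
      obtain ⟨I, t, h1, h2⟩ := ih (true :: l) (if f then true :: a else a)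
        (false :: true :: b) f
      refine ⟨I, t + 2, by simp only [List.length_cons]; omega,
        Reaches.step (b := uCfg (UState.zero f) (bitTape (true :: l) x)
          (bitTape (if f then true :: a else a) []) (bitTape (true :: b) []))
        (BitMachine.step_eq rfl fun i : UTape => ?_)
        (Reaches.step (b := uCfg (UState.read f) (bitTape (true :: l) x)
          (bitTape (if f then true :: a else a) []) (bitTape (false :: true :: b) []))
        (BitMachine.step_eq rfl fun i : UTape => ?_) ?_)⟩
      · cases i <;> cases f <;> simp [uCfg, onUTapes]
      · cases i <;> cases f <;> simp [uCfg, onUTapes]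
      · cases f <;> simpa [programPart, encInput] using h2

theorem length_encInput_le (x : List Bool) : (encInput x).length ≤ 2 * x.length := by
  induction x with
  | nil => simp [encInput]
  | cons b x ih => cases b <;> simp_all [encInput] <;> omega

theorem length_programPart_le (f : Bool) (x : List Bool) :
    (programPart f x).length ≤ x.length := by
  induction x generalizing f with
  | nil => cases f <;> simp [programPart]
  | cons b x ih =>
    have := ih false
    cases f <;> cases b <;> simp [programPart]; omega

theorem u_init (x : List Bool) :
    ∃ I, ∃ t ≤ 5 * x.length + 6, universal.run x t = uCfg UState.pop I
      (bitTape [] (programPart false x)) (bitTape [] (encInput x ++ [true, true, false])) := by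
  obtain ⟨I, t, h1, h2⟩ := u_read [] x [] [] false
  obtain ⟨t', h3, h4⟩ := u_rewind I ((programPart false x).reverse ++ []) []
    (true :: true :: ((encInput x).reverse ++ [])) [false]
  have h5 : universal.init x =
      uCfg (UState.read false) (bitTape [] x) (bitTape [] []) (bitTape [] []) :=
    Prod.ext rfl (funext fun i : UTape => by cases i <;> rfl)
  have h6 := length_encInput_le x
  have h7 := length_programPart_le false x
  simp only [List.append_nil, List.length_reverse, List.length_cons] at h3
  refine ⟨I, t + t', by omega, ?_⟩
  have h8 := h2.trans h4
  rw [← h5] at h8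
  have h9 : true :: true :: ((encInput x).reverse ++ []) =
      ((encInput x) ++ [true, true]).reverse := by simp
  rw [h9, List.append_nil, List.append_nil, List.reverse_reverse, List.reverse_reverse,
    List.append_assoc] at h8
  exact h8

/-! ### Queue machines -/

/-- A finite automaton with a queue: in every step it removes the first letter of the queue, and
depending on it and its state enters a new state and appends letters to the queue. Without new
state, it accepts. States and letters are numbered. -/
structure QueueMachine where
  /-- states -/
  S : Type
  /-- letters -/
  L : Type
  /-- the number of states -/
  nS : ℕ
  /-- the number of letters -/
  nL : ℕ
  /-- the numbering of the states -/
  eS : S ≃ Fin nS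
  /-- the numbering of the letters -/
  eL : L ≃ Fin nL
  /-- the transition function -/
  δ : S → L → Option S × List L

namespace QueueMachine

variable (M : QueueMachine)

/-- One step. -/
def step : Option M.S × List M.L → Option M.S × List M.L
  | (some s, a :: l) => ((M.δ s a).1, l ++ (M.δ s a).2)
  | c => c

/-- The unary code of a state. -/
def offset (s : Option M.S) : ℕ := s.elim (M.nS * M.nL) fun s => M.nL * M.eS s

/-- The code of a word. -/
def encLetters (l : List M.L) : List Bool :=
  l.flatMap fun a => List.replicate (M.eL a) true ++ [false]

/-- The code of a configuration. -/
def encCfg (c : Option M.S × List M.L) : List Bool :=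
  List.replicate (M.offset c.1) true ++ M.encLetters c.2

/-- The record for a state and a letter. -/
def recordOf (s : M.S) (a : M.L) : ℕ × List Bool :=
  (M.offset (M.δ s a).1, M.encLetters (M.δ s a).2)

/-- The program for the universal machine. -/
def records : List (ℕ × List Bool) :=
  List.ofFn fun m : Fin (M.nS * M.nL) =>
    M.recordOf (M.eS.symm (finProdFinEquiv.symm m).1) (M.eL.symm (finProdFinEquiv.symm m).2)

theorem length_records : M.records.length = M.nS * M.nL := by simp [records]

variable {M}

theorem encLetters_cons (a : M.L) (l : List M.L) :
    M.encLetters (a :: l) = List.replicate (M.eL a) true ++ false :: M.encLetters l := by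
  simp [encLetters]

theorem encLetters_append (l l' : List M.L) :
    M.encLetters (l ++ l') = M.encLetters l ++ M.encLetters l' := by
  simp [encLetters]

theorem encCfg_cons (s : Option M.S) (a : M.L) (l : List M.L) :
    M.encCfg (s, a :: l) =
      List.replicate (M.offset s + M.eL a) true ++ false :: M.encLetters l := by
  rw [encCfg, encLetters_cons, List.replicate_add, List.append_assoc]

/-- A state and a letter together form an index below `nS * nL`. The accepting `none` has offset `nS
* nL`, so its indices lie beyond the program, which is what makes the universal machine accept. -/
theorem offset_add_lt (s : M.S) (a : M.L) :
    M.offset (some s) + M.eL a < M.records.length := by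
  rw [length_records]
  have h := (finProdFinEquiv (M.eS s, M.eL a)).isLt
  rw [finProdFinEquiv_apply_val] at h
  simp only at h
  simp only [offset, Option.elim]
  omega

theorem getElem_records (s : M.S) (a : M.L) :
    M.records[M.offset (some s) + M.eL a]'(offset_add_lt s a) = M.recordOf s a := by
  have h : (⟨M.offset (some s) + M.eL a, by
      simpa [length_records] using offset_add_lt s a⟩ : Fin (M.nS * M.nL)) =
      finProdFinEquiv (M.eS s, M.eL a) := by
    apply Fin.ext
    simp only [finProdFinEquiv_apply_val, offset, Option.elim]
    omega
  simp only [records, List.getElem_ofFn]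
  rw [h, Equiv.symm_apply_apply, Equiv.symm_apply_apply, Equiv.symm_apply_apply]

theorem length_record_le {r : ℕ × List Bool} (h : r ∈ M.records) :
    (encRecord r).length ≤ (encProgram M.records).length := by
  obtain ⟨l, l', h⟩ := List.append_of_mem h
  rw [h, encProgram, List.flatMap_append, List.flatMap_cons]
  simp only [List.length_append]
  omega

/-! ### Simulation of queue machines by the universal machine. -/

variable {I : BTape} {pad : List Bool}

/-- The universal machine simulates a step of a queue machine. -/
theorem u_simulates_step (I : BTape) (pad : List Bool) (s : M.S) (a : M.L) (l : List M.L) :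
    ∃ t, 1 ≤ t ∧ t ≤ 6 * (encProgram M.records ++ pad).length +
        2 * (M.encCfg (some s, a :: l)).length + 11 ∧
      (M.encCfg (M.step (some s, a :: l))).length ≤
        (M.encCfg (some s, a :: l)).length + (encProgram M.records ++ pad).length ∧
      Reaches universal.step (uCfg UState.pop I (bitTape [] (encProgram M.records ++ pad))
        (bitTape [] (M.encCfg (some s, a :: l)))) t
        (uCfg UState.pop I (bitTape [] (encProgram M.records ++ pad))
          (bitTape [] (M.encCfg (M.step (some s, a :: l))))) := by
  obtain ⟨t, h1, h2, h3⟩ := u_step I pad (M.encLetters l) M.records _ (offset_add_lt s a)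
  rw [getElem_records] at h3
  have h4 : M.encCfg (M.step (some s, a :: l)) =
      List.replicate (M.recordOf s a).1 true ++ M.encLetters l ++ (M.recordOf s a).2 := by
    simp [encCfg, step, recordOf, encLetters_append]
  -- The new offset and the appended code come from one record, so the data grow by at most the
  -- length of the program.
  have h5 := length_record_le (getElem_records s a ▸ List.getElem_mem (offset_add_lt s a))
  rw [← h4, ← encCfg_cons] at h3
  rw [length_encRecord] at h5
  refine ⟨t, h1, ?_, ?_, h3⟩
  · rw [encCfg_cons, List.length_append (as := List.replicate _ _), List.length_cons]
    omega
  · rw [h4, encCfg_cons]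
    simp only [List.length_append, List.length_cons, List.length_replicate]
    omega

theorem step_none (l : List M.L) : M.step (none, l) = (none, l) := rfl

theorem step_nil (s : Option M.S) : M.step (s, []) = (s, []) := by cases s <;> rfl

/-- In `n` steps the data grow by at most `n` program lengths, which accounts for the summand with
`2 * n`; the last summands pay for the vain search for a record. -/
theorem u_accepts (I : BTape) (hpad : pad.head? ≠ some true) (n : ℕ) (c : Option M.S × List M.L)
    (a : M.L) (l : List M.L) (h : M.step^[n] c = (none, a :: l)) :
    ∃ t c', t ≤ n * (6 * (encProgram M.records ++ pad).length + 2 * (M.encCfg c).length +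
        2 * n * (encProgram M.records ++ pad).length + 11) +
        2 * (encProgram M.records ++ pad).length + 1 ∧
      universal.verdict c' = some true ∧
      Reaches universal.step (uCfg UState.pop I (bitTape [] (encProgram M.records ++ pad))
        (bitTape [] (M.encCfg c))) t c' := by
  induction n generalizing c with
  | zero =>
    obtain rfl : c = (none, a :: l) := h
    obtain ⟨t, c', h1, h2, h3⟩ := u_accept I [] pad (M.encLetters l) hpad M.records
      (M.offset none + M.eL a) (by rw [length_records]; exact Nat.le_add_right _ _)
    rw [encCfg_cons]
    refine ⟨t, c', ?_, h2, h3⟩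
    rw [List.length_append]
    omega
  | succ n ih =>
    rw [Function.iterate_succ_apply] at h
    rcases c with ⟨_ | s, l'⟩
    · obtain ⟨t, c', h1, h2, h3⟩ := ih (none, l') h
      exact ⟨t, c', h1.trans (by gcongr <;> omega), h2, h3⟩
    · rcases l' with _ | ⟨b, l'⟩
      · rw [step_nil, Function.iterate_fixed (step_nil _)] at h
        cases h
      · obtain ⟨t, c', h1, h2, h3⟩ := ih _ h
        obtain ⟨t', -, h4, h5, h6⟩ := u_simulates_step I pad s b l'
        refine ⟨t' + t, c', ?_, h2, h6.trans h3⟩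
        set P := (encProgram M.records ++ pad).length
        set D := (M.encCfg (some s, b :: l')).length
        have h7 : n * (6 * P + 2 * (M.encCfg (M.step (some s, b :: l'))).length + 2 * n * P + 11) ≤
          n * (6 * P + 2 * (D + P) + 2 * n * P + 11) := by gcongr
        nlinarith

/-- Each queue step costs at least one step, hence `n ≤ t`: if the queue machine runs forever, the
universal machine is found in the state `pop` at arbitrarily late times. -/
theorem u_not_accepts (I : BTape) (pad : List Bool) (n : ℕ) (c : Option M.S × List M.L)
    {s : M.S} {a : M.L} {l : List M.L} (h : M.step^[n] c = (some s, a :: l)) :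
    ∃ t, n ≤ t ∧
      Reaches universal.step (uCfg UState.pop I (bitTape [] (encProgram M.records ++ pad))
        (bitTape [] (M.encCfg c))) t
        (uCfg UState.pop I (bitTape [] (encProgram M.records ++ pad))
          (bitTape [] (M.encCfg (some s, a :: l)))) := by
  induction n generalizing c with
  | zero =>
    obtain rfl : c = (some s, a :: l) := h
    exact ⟨0, le_rfl, Reaches.refl _ _⟩
  | succ n ih =>
    rw [Function.iterate_succ_apply] at h
    rcases c with ⟨_ | s', _ | ⟨b, l'⟩⟩
    · rw [step_nil, Function.iterate_fixed (step_nil _)] at h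
      cases h
    · rw [step_none, Function.iterate_fixed (step_none _)] at h
      cases h
    · rw [step_nil, Function.iterate_fixed (step_nil _)] at h
      cases h
    · obtain ⟨t, h1, h2⟩ := ih _ h
      obtain ⟨t', h3, -, -, h4⟩ := u_simulates_step I pad s' b l'
      exact ⟨t' + t, by omega, h4.trans h2⟩

theorem verdict_pop {I P : BTape} {s : Option M.S} {a : M.L} {l : List M.L} :
    universal.verdict (uCfg UState.pop I P (bitTape [] (M.encCfg (s, a :: l)))) = none := by
  rw [BitMachine.verdict_eq_none, encCfg_cons]
  cases M.offset s + M.eL a <;> exact ⟨_, rfl⟩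

theorem length_encLetters_le (l : List M.L) : (M.encLetters l).length ≤ l.length * M.nL := by
  induction l with
  | nil => simp [encLetters]
  | cons a l ih =>
    have := (M.eL a).isLt
    rw [encLetters_cons, List.length_append, List.length_replicate, List.length_cons,
      List.length_cons, Nat.add_mul]
    omega

/-- A bound for the length of the program. -/
theorem length_encProgram_le (h : ∀ s a, (M.δ s a).2.length ≤ 3) :
    (encProgram M.records).length ≤ 10 * (M.nS * M.nL) ^ 2 := by
  -- In units of `nS * nL`: `1` for the offset, `6` for three letters of at most `nL` bits each,
  -- doubled by `markBits`, and `3` for the delimiters.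
  have h1 : ∀ r ∈ M.records, (encRecord r).length ≤ 10 * (M.nS * M.nL) := by
    intro r hr
    obtain ⟨m, hm⟩ := (List.mem_ofFn' _ _).1 hr
    subst hm
    beta_reduce
    generalize hs : M.eS.symm (finProdFinEquiv.symm m).1 = s
    generalize ha : M.eL.symm (finProdFinEquiv.symm m).2 = a
    have h2 := (M.eS s).isLt
    have h3 := (M.eL a).isLt
    have h4 := (length_encLetters_le (M.δ s a).2).trans (Nat.mul_le_mul_right M.nL (h s a))
    have h5 : M.offset (M.δ s a).1 ≤ M.nS * M.nL := by
      rcases (M.δ s a).1 with _ | s'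
      · exact le_rfl
      · rw [offset, Option.elim, Nat.mul_comm]
        exact Nat.mul_le_mul_right _ (M.eS s').isLt.le
    have h6 : M.nL ≤ M.nS * M.nL := Nat.le_mul_of_pos_left _ (by omega)
    change (encRecord (M.recordOf s a)).length ≤ _
    rw [length_encRecord]
    simp only [recordOf]
    omega
  rw [encProgram, List.length_flatMap]
  refine (List.sum_le_card_nsmul _ (10 * (M.nS * M.nL)) fun n hn => ?_).trans ?_
  · obtain ⟨r, hr, rfl⟩ := List.mem_map.1 hn
    exact h1 r hr
  · rw [List.length_map, length_records, smul_eq_mul]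
    exact le_of_eq (by ring)

variable (M)

/-- The queue machine is ready to be started on bit strings: it has a start state and letters for
the bits and for the end of the input with the numbers that `universal` expects. -/
structure IsStart (s : M.S) (b : Bool → M.L) (e : M.L) : Prop where
  state : (M.eS s : ℕ) = 0
  bit (c : Bool) : (M.eL (b c) : ℕ) = c.toNat
  ending : (M.eL e : ℕ) = 2

variable {M}

theorem IsStart.encCfg {s : M.S} {b : Bool → M.L} {e : M.L} (h : M.IsStart s b e)
    (x : List Bool) : M.encCfg (some s, x.map b ++ [e]) = encInput x ++ [true, true, false] := by
  rw [QueueMachine.encCfg, offset, Option.elim, h.state, Nat.mul_zero, List.replicate_zero,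
    List.nil_append, encLetters_append]
  congr 1
  · induction x with
    | nil => rfl
    | cons c x ih =>
      rw [List.map_cons, encLetters_cons, h.bit, ih]
      cases c <;> rfl
  · rw [encLetters_cons, h.ending]
    rfl

theorem IsStart.universal_accepts {s : M.S} {b : Bool → M.L} {e : M.L} (h : M.IsStart s b e)
    {x : List Bool} (hpad : pad.head? ≠ some true)
    (hx : programPart false x = encProgram M.records ++ pad) {n : ℕ} {a : M.L} {l : List M.L}
    (hn : M.step^[n] (some s, x.map b ++ [e]) = (none, a :: l)) :
    ∃ t ≤ n * (10 * x.length + 2 * n * x.length + 17) + 7 * x.length + 7,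
      universal.verdict (universal.run x t) = some true := by
  obtain ⟨I, t, h1, h2⟩ := u_init x
  obtain ⟨t', c, h3, h4, h5⟩ := u_accepts I hpad n _ a l hn
  have h6 := length_programPart_le false x
  have h7 := length_encInput_le x
  rw [h.encCfg, ← hx] at h3 h5
  rw [List.length_append] at h3
  refine ⟨t + t', ?_, by rw [BitMachine.run_add_of_reaches h2 h5, h4]⟩
  calc t + t' ≤ 5 * x.length + 6 + (n * (6 * x.length + 2 * (2 * x.length + 3) +
        2 * n * x.length + 11) + 2 * x.length + 1) := by
        refine add_le_add h1 (h3.trans ?_)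
        gcongr
        exact le_rfl
    _ = _ := by ring

theorem IsStart.universal_not_accepts {s : M.S} {b : Bool → M.L} {e : M.L} (h : M.IsStart s b e)
    {x : List Bool} (hx : programPart false x = encProgram M.records ++ pad)
    (hn : ∀ n, ∃ s' a l, M.step^[n] (some s, x.map b ++ [e]) = (some s', a :: l)) :
    ¬ universal.Accepts x := by
  rintro ⟨n, h1⟩
  obtain ⟨I, t, -, h2⟩ := u_init x
  obtain ⟨s', a, l, h3⟩ := hn n
  obtain ⟨t', h4, h5⟩ := u_not_accepts I pad n _ h3
  rw [h.encCfg, ← hx] at h5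
  have h6 := BitMachine.verdict_of_le h1 (show n ≤ t + t' by omega)
  rw [BitMachine.run_add_of_reaches h2 h5, verdict_pop] at h6
  cases h6

end QueueMachine

/-! ### Segments of two-way infinite sequences -/

/-- The list `f j, f (j + 1), …` of length `a`. -/
def seg {α : Type*} (f : ℤ → α) (j : ℤ) : ℕ → List α
  | 0 => []
  | a + 1 => f j :: seg f (j + 1) a

theorem seg_succ_last {α : Type*} (f : ℤ → α) (j : ℤ) (a : ℕ) :
    seg f j (a + 1) = seg f j a ++ [f (j + a)] := by
  induction a generalizing j with
  | zero => simp [seg]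
  | succ a ih =>
    rw [seg, ih (j + 1), seg, List.cons_append]
    push_cast
    rw [add_assoc, add_comm (1 : ℤ)]

theorem seg_congr {α : Type*} {f g : ℤ → α} {j : ℤ} {a : ℕ}
    (h : ∀ i, j ≤ i → i < j + a → f i = g i) : seg f j a = seg g j a := by
  induction a generalizing j with
  | zero => rfl
  | succ a ih =>
    rw [seg, seg, h j le_rfl (by push_cast; omega), ih fun i h1 h2 => h i (by omega) (by
      push_cast; omega)]

theorem seg_getI {α : Type*} [Inhabited α] (f : ℤ → α) (j : ℤ) (a n : ℕ) :
    (seg f j a).getI n = if n < a then f (j + n) else default := by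
  induction a generalizing j n with
  | zero => simp [seg]
  | succ a ih =>
    cases n with
    | zero => simp [seg]
    | succ n =>
      rw [seg, List.getI_cons_succ, ih]
      push_cast
      rw [add_assoc, add_comm (1 : ℤ)]
      simp

theorem seg_map_getI {α β : Type*} [Inhabited α] (g : α → β) (l : List α) (f : ℤ → β)
    (j : ℤ) (h : ∀ n : ℕ, n < l.length → f (j + n) = g (l.getI n)) :
    seg f j l.length = l.map g := by
  induction l generalizing j with
  | nil => rfl
  | cons a l ih =>
    rw [List.length_cons, seg, List.map_cons, ih (j + 1)]
    · have := h 0 (by simp)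
      simpa using this
    · intro n hn
      have := h (n + 1) (by simpa using hn)
      rw [List.getI_cons_succ] at this
      rw [← this]
      push_cast
      rw [add_assoc, add_comm (1 : ℤ)]

theorem tapeBits_eq_seg {A : Type} (T : Tape (TapeSymbol A)) (a : ℕ)
    (h : ∀ j : ℤ, (a : ℤ) < j → T.nth j = blank) :
    tapeBits T = leadingBits (seg T.nth 0 (a + 1)) := by
  have h1 : T.right₀ = ListBlank.mk (seg T.nth 0 (a + 1)) := by
    refine ListBlank.ext fun n => ?_
    rw [Tape.right₀_nth, ListBlank.nth_mk, seg_getI]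
    split_ifs with hn
    · simp
    · exact h n (by omega)
  rw [tapeBits, h1]
  rfl

/-! ### Simulation of an oracle machine by a queue machine

The oracle is replaced by an automaton with state space `R`. The queue holds the columns of the
tapes with the numbers `1, 2, …, ` then a seam, and then the columns up to the number `-2`, where
the heads are in column `0`. The columns `-1` and `0` are part of the state. One step of the oracle
machine corresponds to one pass over the queue. -/

/-- An automaton that decides about oracle queries. -/
structure Answerer where
  /-- states -/
  R : Type
  [finR : Finite R]
  /-- the initial state -/
  start : R
  /-- the transition function -/
  push : R → Bool → R
  /-- acceptance -/
  ans : R → Bool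

namespace OracleTM

variable (M : OracleTM) (F : Answerer)

/-- Columns: one symbol for each tape. -/
abbrev Column := M.K → TapeSymbol M.A

/-- The number `j` column of given tapes. -/
def column {M : OracleTM} (T : M.K → Tape (TapeSymbol M.A)) (j : ℤ) : M.Column :=
  fun i => (T i).nth j

/-- The blank column. -/
def blankColumn : M.Column := fun _ => blank

/-- The column with a given bit on the input tape. -/
def inputColumn (b : Bool) : M.Column := fun i => if i = M.inTape then bit b else blank

/-- The control of a pass: the two successor states for the answers of the oracle, the movements of
the heads, the columns `-1` and `0`, the last two columns that have been seen, and whether the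
pass is at its beginning. -/
structure Control where
  y : M.Q
  n : M.Q
  d : M.K → Option Dir
  prev : M.Column
  head : M.Column
  p : M.Column
  u : M.Column
  first : Bool

instance (A : Type) [Finite A] : Finite (TapeSymbol A) :=
  Finite.of_injective (β := Option (Bool ⊕ A)) (fun s => match s with
    | blank => none
    | bit b => some (Sum.inl b)
    | extra a => some (Sum.inr a)) fun a b h => by
      cases a <;> cases b <;> simp_all

instance : Finite Dir :=
  Finite.of_surjective ![Dir.left, Dir.right] fun d => by cases d <;> decide

instance : Finite M.Q := M.finQ
instance : Finite M.K := M.finK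
instance : Finite M.A := M.finA
instance : Finite F.R := F.finR

instance : Finite M.Control :=
  Finite.of_injective (fun c : M.Control => (c.y, c.n, c.d, c.prev, c.head, c.p, c.u, c.first))
    fun a b h => by cases a; cases b; simp_all

/-- Letters of the queue machine: bits and end of input; the seam; and columns, with a mark at the
beginning of a pass. -/
abbrev QLetter := Fin 3 ⊕ Option (Bool × M.Column)

/-- States of the queue machine: start state; idling (forever) or reading the input; passes, with
the state of the automaton for the oracle queries and whether it is still reading. -/
abbrev QState := Fin 1 ⊕ (Option M.Column ⊕ (M.Control × (F.R × Bool)))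

/-- Letters for bits of the input. -/
def bitLetter (b : Bool) : M.QLetter := Sum.inl (if b then 1 else 0)

/-- The letter for the end of the input. -/
def endLetter : M.QLetter := Sum.inl 2

/-- The letter for the seam. -/
def seamLetter : M.QLetter := Sum.inr none

/-- The letter for a column. -/
def columnLetter (o : Bool) (c : M.Column) : M.QLetter := Sum.inr (some (o, c))

/-- The idle state. -/
def idleState : M.QState F := Sum.inr (Sum.inl none)

variable {M F}

/-- A column after movements of the heads, in terms of the columns `p`, `u`, `v` around it. -/
def shift (d : M.K → Option Dir) (p u v : M.Column) : M.Column := fun i =>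
  match d i with
  | none => u i
  | some Dir.left => p i
  | some Dir.right => v i

/-- Feed a symbol to the automaton for the oracle queries. -/
def readSymbol {A : Type} (F : Answerer) (r : F.R × Bool) (s : TapeSymbol A) : F.R × Bool :=
  match r.2, s with
  | true, bit b => (F.push r.1 b, true)
  | _, _ => (r.1, false)

/-- The state at the beginning of a pass. -/
def launch (F : Answerer) (y n : M.Q) (d : M.K → Option Dir) (prev head : M.Column) : M.QState F :=
  Sum.inr (Sum.inr (⟨y, n, d, prev, head, prev, head, true⟩,
    readSymbol F (F.start, true) (head M.queryTape)))

/-- The state for the simulation of a step. -/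
def begin (F : Answerer) (q : M.Q) (prev head : M.Column) : Option (M.QState F) :=
  match M.δ q head with
  | Action.move q' w =>
    some (launch F q' q' (fun i => (w i).2) prev fun i => (w i).1)
  | Action.query y n => some (launch F y n (fun _ => none) prev head)
  | Action.halt true => some (idleState M F)
  | Action.halt false => none

variable (M F)

/-- The transition function of the queue machine. -/
def queueδ : M.QState F → M.QLetter → Option (M.QState F) × List M.QLetter
  | Sum.inl _, Sum.inl b => (some (Sum.inr (Sum.inl (some (M.inputColumn (b == 1))))), [])
  | Sum.inr (Sum.inl (some c)), Sum.inl b =>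
    if b = 2 then (begin F M.start M.blankColumn c, [M.seamLetter])
    else (some (Sum.inr (Sum.inl (some c))), [M.columnLetter false (M.inputColumn (b == 1))])
  -- The seam follows column `r`. The new columns `r` and `r + 1` are written, so the window grows
  -- to the right; then the last two columns are taken to be the blank ones left of the window, so
  -- it also grows to the left. Feeding the automaton stops here, as query strings extend to the
  -- right only.
  | Sum.inr (Sum.inr (σ, r)), Sum.inr none =>
    (some (Sum.inr (Sum.inr ({ σ with p := M.blankColumn, u := M.blankColumn, first := false },
        (r.1, false)))),
      [M.columnLetter σ.first (shift σ.d σ.p σ.u M.blankColumn),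
        M.columnLetter false (shift σ.d σ.u M.blankColumn M.blankColumn), M.seamLetter])
  | Sum.inr (Sum.inr (σ, r)), Sum.inr (some (false, c)) =>
    (some (Sum.inr (Sum.inr ({ σ with p := σ.u, u := c, first := false },
        readSymbol F r (c M.queryTape)))),
      [M.columnLetter σ.first (shift σ.d σ.p σ.u c)])
  -- The marked letter is the new column `0`, the first letter written in this pass: the pass is
  -- over. Column `-2` goes to the queue, and columns `-1` and `0` stay in the control.
  | Sum.inr (Sum.inr (σ, r)), Sum.inr (some (true, c)) =>
    (begin F (if F.ans r.1 then σ.y else σ.n) (shift σ.d σ.u σ.prev σ.head) c,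
      [M.columnLetter false (shift σ.d σ.p σ.u σ.prev)])
  | _, a => (some (idleState M F), [a])

/-- The queue machine that simulates `M`. It accepts if `M` rejects. -/
noncomputable def queueMachine : QueueMachine where
  S := M.QState F
  L := M.QLetter
  nS := 1 + Nat.card (Option M.Column ⊕ (M.Control × (F.R × Bool)))
  nL := 3 + Nat.card (Option (Bool × M.Column))
  eS := ((Equiv.refl _).sumCongr (Finite.equivFin _)).trans finSumFinEquiv
  eL := ((Equiv.refl _).sumCongr (Finite.equivFin _)).trans finSumFinEquiv
  δ := M.queueδ F

/-- The summands `Fin 1` and `Fin 3` come first in the numberings, which fixes the numbers of the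
start state and the input letters; all others are numbered arbitrarily. -/
theorem isStart_queueMachine :
    (M.queueMachine F).IsStart (Sum.inl 0 : M.QState F) M.bitLetter M.endLetter where
  state := rfl
  bit c := by cases c <;> rfl
  ending := rfl

theorem length_queueδ_le (s : M.QState F) (a : M.QLetter) : (M.queueδ F s a).2.length ≤ 3 := by
  unfold queueδ
  split <;> (try split_ifs) <;> simp

variable {M F}

/-! ### One pass over the queue. -/

/-- The queue for given tapes. -/
def queueOf (T : M.K → Tape (TapeSymbol M.A)) (r l : ℕ) : List M.QLetter :=
  seg (fun j => M.columnLetter false (column T j)) 1 r ++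
    M.seamLetter :: seg (fun j => M.columnLetter false (column T j)) (-l - 1) l

/-- Outside of the columns from `-l - 1` to `r`, the tapes are blank. -/
def BlankOutside (T : M.K → Tape (TapeSymbol M.A)) (r l : ℕ) : Prop :=
  ∀ i, ∀ j : ℤ, ((r : ℤ) < j ∨ j < -l - 1) → (T i).nth j = blank

/-- The tapes after movements of the heads. -/
def moved (W : M.K → Tape (TapeSymbol M.A)) (d : M.K → Option Dir) :
    M.K → Tape (TapeSymbol M.A) := fun i =>
  match d i with
  | none => W i
  | some e => (W i).move e

theorem column_moved (W : M.K → Tape (TapeSymbol M.A)) (d : M.K → Option Dir) (j : ℤ) :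
    column (moved W d) j = shift d (column W (j - 1)) (column W j) (column W (j + 1)) := by
  funext i
  simp only [column, moved, shift]
  rcases d i with _ | _ | _ <;> simp

theorem BlankOutside.moved {W : M.K → Tape (TapeSymbol M.A)} {r l : ℕ} (h : BlankOutside W r l)
    (d : M.K → Option Dir) : BlankOutside (moved W d) (r + 1) (l + 1) := by
  intro i j hj
  push_cast at hj
  simp only [OracleTM.moved]
  rcases d i with _ | _ | _
  · exact h i j (by omega)
  · rw [Tape.move_left_nth]; exact h i _ (by omega)
  · rw [Tape.move_right_nth]; exact h i _ (by omega)

theorem BlankOutside.column {W : M.K → Tape (TapeSymbol M.A)} {r l : ℕ} (h : BlankOutside W r l)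
    {j : ℤ} (hj : (r : ℤ) < j ∨ j < -l - 1) : column W j = M.blankColumn :=
  funext fun i => h i j hj

/-- The state of the queue machine between the columns `j` and `j + 1`. -/
def sweepState (F : Answerer) (W : M.K → Tape (TapeSymbol M.A)) (y n : M.Q) (d : M.K → Option Dir)
    (j : ℤ) (r : F.R × Bool) : M.QState F :=
  Sum.inr (Sum.inr (⟨y, n, d, column W (-1), column W 0, column W (j - 1), column W j,
    decide (j = 0)⟩, r))

/-- The letter for column `j`, with a mark at `0`. -/
def markedLetter (T : M.K → Tape (TapeSymbol M.A)) (j : ℤ) : M.QLetter :=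
  M.columnLetter (decide (j = 0)) (column T j)

/-- A column after the head movements depends on its two neighbours and itself only, so column `j`
can be written as soon as column `j + 1` is read. By `ha`, the segment does not arrive at column
`0`, where `first` would have to become true again. -/
theorem sweep_segment (W : M.K → Tape (TapeSymbol M.A)) (y n : M.Q) (d : M.K → Option Dir)
    (j : ℤ) (r : F.R × Bool) (a : ℕ) (ha : 0 ≤ j ∨ j + a < 0) (l : List M.QLetter) :
    Reaches (M.queueMachine F).step
      (some (sweepState F W y n d j r),
        seg (fun j => M.columnLetter false (column W j)) (j + 1) a ++ l) a
      (some (sweepState F W y n d (j + a)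
        ((seg (fun j => column W j M.queryTape) (j + 1) a).foldl (readSymbol F) r)),
        l ++ seg (markedLetter (moved W d)) j a) := by
  induction a generalizing j r l with
  | zero => simpa [seg] using Reaches.refl _ _
  | succ a ih =>
    have h := ih (j + 1) (readSymbol F r (column W (j + 1) M.queryTape))
      (by push_cast at ha; omega) (l ++ [markedLetter (moved W d) j])
    rw [seg, seg, seg, List.foldl_cons]
    push_cast
    rw [show j + ((a : ℤ) + 1) = j + 1 + a by ring]
    rw [List.append_assoc, List.singleton_append] at h
    refine Reaches.step ?_ h
    have h1 : decide (j + 1 = 0) = false := by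
      push_cast at ha
      rw [decide_eq_false_iff_not]
      omega
    rw [markedLetter, column_moved]
    simp [QueueMachine.step, queueMachine, sweepState, queueδ, columnLetter, h1]
    exact List.append_assoc ..

theorem foldl_readSymbol_false {A : Type} (r : F.R) (l : List (TapeSymbol A)) :
    l.foldl (readSymbol F) (r, false) = (r, false) := by
  induction l with
  | nil => rfl
  | cons s l ih => exact ih

theorem foldl_readSymbol {A : Type} (r : F.R) (l : List (TapeSymbol A)) :
    (l.foldl (readSymbol F) (r, true)).1 = (leadingBits l).foldl F.push r := by
  induction l generalizing r with
  | nil => rfl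
  | cons s l ih =>
    rw [List.foldl_cons]
    cases s with
    | blank => exact congrArg Prod.fst (foldl_readSymbol_false r l)
    | bit b => exact ih _
    | extra a => exact congrArg Prod.fst (foldl_readSymbol_false r l)

theorem seg_markedLetter (T : M.K → Tape (TapeSymbol M.A)) (j : ℤ) (a : ℕ)
    (h : 0 < j ∨ j + a ≤ 0) :
    seg (markedLetter T) j a = seg (fun j => M.columnLetter false (column T j)) j a := by
  refine seg_congr fun i h1 h2 => ?_
  rw [markedLetter, decide_eq_false (by omega)]

/-- A pass over the queue. -/
theorem sweep (W : M.K → Tape (TapeSymbol M.A)) (y n : M.Q) (d : M.K → Option Dir) (r l : ℕ)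
    (hW : BlankOutside W r l) :
    Reaches (M.queueMachine F).step
      (some (launch F y n d (column W (-1)) (column W 0)), queueOf W r l) (r + l + 2)
      (begin F (if F.ans ((leadingBits (seg (W M.queryTape).nth 0 (r + 1))).foldl F.push F.start)
          then y else n) (column (moved W d) (-1)) (column (moved W d) 0),
        queueOf (moved W d) (r + 1) (l + 1)) := by
  set T := moved W d with hT
  set left := seg (fun j => M.columnLetter false (column W j)) (-l - 1) l with hleft
  have h1 := sweep_segment (F := F) W y n d 0
    (readSymbol F (F.start, true) (column W 0 M.queryTape)) r (Or.inl le_rfl)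
    (M.seamLetter :: left)
  rw [← List.foldl_cons (f := readSymbol F), show column W 0 M.queryTape ::
    seg (fun j => column W j M.queryTape) (0 + 1) r = seg (W M.queryTape).nth 0 (r + 1) from rfl,
    zero_add (r : ℤ)] at h1
  have h0 := foldl_readSymbol (F := F) F.start (seg (W M.queryTape).nth 0 (r + 1))
  set rr := (seg (W M.queryTape).nth 0 (r + 1)).foldl (readSymbol F) (F.start, true) with hrr
  have h2 : (M.queueMachine F).step (some (sweepState F W y n d r rr),
      M.seamLetter :: left ++ seg (markedLetter T) 0 r) =
      (some (sweepState F W y n d (-l - 2) (rr.1, false)), left ++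
        (seg (markedLetter T) 0 r ++ [markedLetter T r, markedLetter T (r + 1), M.seamLetter])) := by
    have e1 : decide ((r : ℤ) + 1 = 0) = false := decide_eq_false (by omega)
    have e2 : decide (-(l : ℤ) - 2 = 0) = false := decide_eq_false (by omega)
    rw [markedLetter, markedLetter, hT, column_moved, column_moved, e1,
      hW.column (j := r + 1) (by omega), hW.column (j := r + 1 + 1) (by omega),
      add_sub_cancel_right, sweepState, sweepState, e2, hW.column (j := -l - 2) (by omega),
      hW.column (j := -l - 2 - 1) (by omega)]
    refine Prod.ext rfl ?_
    exact List.append_assoc ..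
  have h3 := sweep_segment (F := F) W y n d (-l - 2) (rr.1, false) l (Or.inr (by omega))
    (seg (markedLetter T) 0 r ++ [markedLetter T r, markedLetter T (r + 1), M.seamLetter])
  rw [foldl_readSymbol_false, show -(l : ℤ) - 2 + l = -2 by ring,
    show -(l : ℤ) - 2 + 1 = -l - 1 by ring, ← hleft] at h3
  have h4 : seg (markedLetter T) 0 r ++ [markedLetter T r, markedLetter T (r + 1), M.seamLetter] =
      M.columnLetter true (column T 0) ::
        (seg (fun j => M.columnLetter false (column T j)) 1 (r + 1) ++ [M.seamLetter]) := by
    rw [← seg_markedLetter T 1 (r + 1) (Or.inl one_pos)]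
    change _ = seg (markedLetter T) 0 (r + 1 + 1) ++ [M.seamLetter]
    rw [seg_succ_last, seg_succ_last]
    simp
  have h5 : (M.queueMachine F).step (some (sweepState F W y n d (-2) (rr.1, false)),
      M.columnLetter true (column T 0) ::
        (seg (fun j => M.columnLetter false (column T j)) 1 (r + 1) ++ [M.seamLetter]) ++
        seg (markedLetter T) (-l - 2) l) =
      (begin F (if F.ans rr.1 then y else n) (column T (-1)) (column T 0),
        queueOf T (r + 1) (l + 1)) := by
    refine Prod.ext ?_ ?_
    · rw [hT, column_moved W d (-1)]
      rfl
    · have e1 : queueOf T (r + 1) (l + 1) =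
          seg (fun j => M.columnLetter false (column T j)) 1 (r + 1) ++ [M.seamLetter] ++
            seg (markedLetter T) (-l - 2) l ++ [markedLetter T (-2)] := by
        have e2 : markedLetter T (-2) = markedLetter T (-l - 2 + l) := by
          rw [show -(l : ℤ) - 2 + l = -2 by ring]
        rw [List.append_assoc, e2, ← seg_succ_last, seg_markedLetter _ _ _ (Or.inr (by
          push_cast; omega)), queueOf, List.append_assoc]
        push_cast
        rw [show -((l : ℤ) + 1) - 1 = -l - 2 by ring]
        rfl
      rw [e1, markedLetter, hT, column_moved W d (-2)]
      rfl
  rw [h4] at h2 h3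
  rw [← h0]
  have h6 := (h1.trans (Reaches.step h2 h3)).trans (Reaches.single h5)
  rw [show r + (l + 1) + 1 = r + l + 2 by ring] at h6
  exact h6

/-- The automaton `F` answers the queries of `M` correctly in a configuration. -/
def AnswersIn (F : Answerer) (O : Set (List Bool)) (c : M.Cfg) : Prop :=
  ∀ y n, M.action c = Action.query y n →
    (F.ans ((tapeBits (c.tape M.queryTape)).foldl F.push F.start) = true ↔
      tapeBits (c.tape M.queryTape) ∈ O)

/-- The configuration of the queue machine for a configuration of `M`. -/
def queueCfg (F : Answerer) (c : M.Cfg) (r l : ℕ) : Option (M.QState F) × List M.QLetter :=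
  (begin F c.state (column c.tape (-1)) (column c.tape 0), queueOf c.tape r l)

/-- The queue machine simulates a step of `M`. -/
theorem queueMachine_step {O : Set (List Bool)} {c : M.Cfg} {r l : ℕ}
    (hc : BlankOutside c.tape r l) (hF : AnswersIn F O c)
    (hh : ∀ b, M.action c ≠ Action.halt b) :
    BlankOutside (M.step O c).tape (r + 1) (l + 1) ∧
    Reaches (M.queueMachine F).step (queueCfg F c r l) (r + l + 2)
      (queueCfg F (M.step O c) (r + 1) (l + 1)) := by
  have hcol : (fun i => (c.tape i).head) = column c.tape 0 := rfl
  rcases ha : M.action c with ⟨q', w⟩ | ⟨y, n⟩ | b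
  · set W : M.K → Tape (TapeSymbol M.A) := fun i => (c.tape i).write (w i).1 with hWdef
    have hstep : M.step O c = ⟨q', moved W fun i => (w i).2⟩ := by
      simp only [step, ha]
      congr 1
    have hne : ∀ j : ℤ, j ≠ 0 → column W j = column c.tape j := fun j hj => by
      funext i
      simp [column, hWdef, hj]
    have hW : BlankOutside W r l := fun i j hj => by
      have : j ≠ 0 := by omega
      simp only [hWdef, Tape.write_nth, if_neg this]
      exact hc i j hj
    have h0 : (fun i => (w i).1) = column W 0 := rfl
    -- Writing touches column `0` only, which is in the control and not in the queue.
    have hq : queueOf W r l = queueOf c.tape r l := by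
      unfold queueOf
      congr 1
      · exact seg_congr fun i h1 h2 => by rw [hne i (by omega)]
      · congr 1
        exact seg_congr fun i h1 h2 => by rw [hne i (by omega)]
    -- Both successor states are `q'`, so the answer of the automaton, which runs in every pass,
    -- does not matter.
    have h := sweep (F := F) W q' q' (fun i => (w i).2) r l hW
    rw [ite_self, hne _ (by norm_num), ← h0, hq] at h
    rw [hstep]
    refine ⟨hW.moved _, ?_⟩
    have hb : begin F c.state (column c.tape (-1)) (column c.tape 0) =
        some (launch F q' q' (fun i => (w i).2) (column c.tape (-1)) fun i => (w i).1) := by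
      rw [action, hcol] at ha
      simp only [begin, ha]
    rw [queueCfg, hb]
    exact h
  · have hstep : M.step O c = ⟨if F.ans ((tapeBits (c.tape M.queryTape)).foldl F.push F.start)
        then y else n, moved c.tape fun _ => none⟩ := by
      classical
      simp only [step, ha]
      have := hF y n ha
      by_cases hm : tapeBits (c.tape M.queryTape) ∈ O
      · simp [hm, this.2 hm]; rfl
      · have h1 : ¬ F.ans ((tapeBits (c.tape M.queryTape)).foldl F.push F.start) = true :=
          fun h => hm (this.1 h)
        simp [hm, h1]; rfl
    have h := sweep (F := F) c.tape y n (fun _ => none) r l hc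
    rw [← tapeBits_eq_seg _ r fun j hj => hc _ j (Or.inl hj)] at h
    rw [hstep]
    refine ⟨hc.moved _, ?_⟩
    have hb : begin F c.state (column c.tape (-1)) (column c.tape 0) =
        some (launch F y n (fun _ => none) (column c.tape (-1)) (column c.tape 0)) := by
      rw [action, hcol] at ha
      simp only [begin, ha]
    rw [queueCfg, hb]
    exact h
  · exact absurd ha (hh b)

/-! ### Loading the input, and complete runs. -/

theorem nth_mk₁ {A : Type} (l : List (TapeSymbol A)) (j : ℤ) :
    (Tape.mk₁ l).nth j = if 0 ≤ j then l.getI j.toNat else blank := by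
  obtain ⟨n, rfl | rfl⟩ := Int.eq_nat_or_neg j
  · rw [Tape.mk₁, Tape.mk₂, Tape.mk'_nth_nat]
    simp
  · cases n with
    | zero =>
      change (Tape.mk₁ l).nth ((0 : ℕ) : ℤ) = _
      rw [Tape.mk₁, Tape.mk₂, Tape.mk'_nth_nat]
      cases l <;> rfl
    | succ n =>
      rw [if_neg (by push_cast; omega)]
      change (ListBlank.mk []).nth n = _
      rw [ListBlank.nth_mk, List.getI_nil]
      rfl

theorem column_init_nat (x : List Bool) (j : ℕ) (hj : j < x.length) :
    column (M.init x).tape j = M.inputColumn x[j] := by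
  funext i
  simp only [column, init, inputColumn]
  split_ifs
  · rw [nth_mk₁, if_pos (by omega), Int.toNat_natCast, List.getI_eq_getElem _ (by simpa using hj),
      List.getElem_map]
  · rw [nth_mk₁, if_pos (by omega), List.getI_nil]
    rfl

theorem blankOutside_init (b : Bool) (x : List Bool) :
    BlankOutside (M.init (b :: x)).tape x.length 0 := by
  intro i j hj
  simp only [init]
  split_ifs
  · rw [nth_mk₁]
    split_ifs
    · rw [List.getI_eq_default]
      · rfl
      · simp only [List.length_map, List.length_cons]
        push_cast at hj
        omega
    · rfl
  · rw [nth_mk₁, List.getI_nil]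
    exact ite_self _

theorem queueMachine_read (c : M.Column) (x : List Bool) (l : List M.QLetter) :
    Reaches (M.queueMachine F).step
      (some (Sum.inr (Sum.inl (some c)) : M.QState F), x.map M.bitLetter ++ l) x.length
      (some (Sum.inr (Sum.inl (some c)) : M.QState F),
        l ++ x.map fun b => M.columnLetter false (M.inputColumn b)) := by
  induction x generalizing l with
  | nil => simpa using Reaches.refl _ _
  | cons b x ih =>
    have h := ih (l ++ [M.columnLetter false (M.inputColumn b)])
    rw [List.append_assoc, List.singleton_append, ← List.append_assoc] at h
    refine Reaches.step ?_ h
    cases b <;> rfl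

/-- The start configuration of the queue machine for an input. -/
def queueStart (M : OracleTM) (F : Answerer) (x : List Bool) :
    Option (M.QState F) × List M.QLetter :=
  (some (Sum.inl 0), x.map M.bitLetter ++ [M.endLetter])

/-- The first bit becomes column `0` in the control; the others pass through the queue and come back
as the columns from `1` on. This is why the input must be nonempty. -/
theorem queueMachine_init (b : Bool) (x : List Bool) :
    Reaches (M.queueMachine F).step (queueStart M F (b :: x)) (x.length + 2)
      (queueCfg F (M.init (b :: x)) x.length 0) := by
  have h1 := queueMachine_read (F := F) (M.inputColumn b) x [M.endLetter]
  have h2 : (M.queueMachine F).step (queueStart M F (b :: x)) =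
      (some (Sum.inr (Sum.inl (some (M.inputColumn b)))), x.map M.bitLetter ++ [M.endLetter]) := by
    cases b <;> exact Prod.ext rfl (List.append_nil _)
  have h3 : (M.queueMachine F).step (some (Sum.inr (Sum.inl (some (M.inputColumn b)))),
      [M.endLetter] ++ x.map fun b => M.columnLetter false (M.inputColumn b)) =
      queueCfg F (M.init (b :: x)) x.length 0 := by
    have h4 : column (M.init (b :: x)).tape (-1) = M.blankColumn :=
      funext fun i => by
        simp only [column, init]
        split_ifs <;> exact nth_mk₁ _ _
    have h5 : column (M.init (b :: x)).tape 0 = M.inputColumn b :=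
      column_init_nat (b :: x) 0 (by simp)
    have h6 : seg (fun j => M.columnLetter false (column (M.init (b :: x)).tape j)) 1 x.length =
        x.map fun b => M.columnLetter false (M.inputColumn b) := by
      refine seg_map_getI _ _ _ _ fun n hn => ?_
      have := column_init_nat (M := M) (b :: x) (n + 1) (by simpa using hn)
      rw [List.getElem_cons_succ] at this
      rw [List.getI_eq_getElem _ hn, ← this]
      push_cast
      rw [add_comm]
    rw [queueCfg, h4, h5, queueOf, h6]
    rfl
  rw [show x.length + 2 = x.length + 1 + 1 by ring]
  exact (Reaches.step h2 h1).trans (Reaches.single h3)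

theorem cfgAt_succ (M : OracleTM) (O : Set (List Bool)) (x : List Bool) (t : ℕ) :
    M.cfgAt O x (t + 1) = M.step O (M.cfgAt O x t) := by
  rw [cfgAt, cfgAt, Function.iterate_succ_apply']

/-- The queue machine simulates `M`. -/
theorem queueMachine_run {O : Set (List Bool)} (b : Bool) (x : List Bool) (t : ℕ)
    (hF : ∀ s < t, AnswersIn F O (M.cfgAt O (b :: x) s))
    (hh : ∀ s < t, ∀ v, M.action (M.cfgAt O (b :: x) s) ≠ Action.halt v) :
    BlankOutside (M.cfgAt O (b :: x) t).tape (x.length + t) t ∧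
    Reaches (M.queueMachine F).step (queueStart M F (b :: x))
      (x.length + 2 + t * (x.length + 1 + t))
      (queueCfg F (M.cfgAt O (b :: x) t) (x.length + t) t) := by
  induction t with
  | zero =>
    rw [Nat.zero_mul]
    exact ⟨blankOutside_init b x, queueMachine_init b x⟩
  | succ t ih =>
    obtain ⟨h1, h2⟩ := ih (fun s hs => hF s (by omega)) fun s hs => hh s (by omega)
    obtain ⟨h3, h4⟩ := queueMachine_step h1 (hF t (by omega)) (hh t (by omega))
    rw [cfgAt_succ]
    refine ⟨h3, ?_⟩
    have h5 := h2.trans h4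
    -- Pass number `s` takes `x.length + 2 * s + 2` steps; over `s < t` they sum to `t * (x.length +
    -- 1 + t)`.
    rw [show x.length + 2 + t * (x.length + 1 + t) + (x.length + t + t + 2) =
      x.length + 2 + (t + 1) * (x.length + 1 + (t + 1)) by ring] at h5
    exact h5

theorem cfgAt_of_halt {O : Set (List Bool)} {x : List Bool} {s t : ℕ} {v : Bool}
    (h : M.action (M.cfgAt O x s) = Action.halt v) (hst : s ≤ t) :
    M.cfgAt O x t = M.cfgAt O x s := by
  induction t, hst using Nat.le_induction with
  | base => rfl
  | succ t _ ih => rw [cfgAt_succ, ih, step, h]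

/-- When `M` halts, the queue machine reaches a corresponding configuration. -/
theorem queueMachine_halt {O : Set (List Bool)} {x : List Bool} (hx : x ≠ []) {t : ℕ} {v : Bool}
    (hF : ∀ s, AnswersIn F O (M.cfgAt O x s)) (h : M.HaltsWithin O x t v) :
    ∃ n ≤ x.length + 1 + t * (x.length + t), ∃ a l,
      Reaches (M.queueMachine F).step (queueStart M F x) n
        (if v then some (idleState M F) else none, a :: l) := by
  classical
  obtain ⟨b, x, rfl⟩ := List.exists_cons_of_ne_nil hx
  -- The passes follow `M` only until it halts, so the first halting time is used; the bound is
  -- monotone in it.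
  have h1 : ∃ s, ∃ v, M.action (M.cfgAt O (b :: x) s) = Action.halt v := ⟨t, v, h⟩
  obtain ⟨v', h2⟩ := Nat.find_spec h1
  set s := Nat.find h1
  have h3 : s ≤ t := Nat.find_min' h1 ⟨v, h⟩
  rw [HaltsWithin, cfgAt_of_halt h2 h3, h2] at h
  obtain rfl : v' = v := by injection h
  obtain ⟨-, h4⟩ := queueMachine_run (F := F) b x s (fun r _ => hF r)
    fun r hr v hv => Nat.find_min h1 hr ⟨v, hv⟩
  have h5 : begin F (M.cfgAt O (b :: x) s).state (column (M.cfgAt O (b :: x) s).tape (-1))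
      (column (M.cfgAt O (b :: x) s).tape 0) = if v' then some (idleState M F) else none := by
    rw [action, show (fun i => ((M.cfgAt O (b :: x) s).tape i).head) =
      column (M.cfgAt O (b :: x) s).tape 0 from rfl] at h2
    simp only [begin, h2]
    cases v' <;> rfl
  rw [queueCfg, h5] at h4
  obtain ⟨a, l, h6⟩ := List.exists_cons_of_ne_nil (l := queueOf (M.cfgAt O (b :: x) s).tape
    (x.length + s) s) (by simp [queueOf])
  rw [h6] at h4
  refine ⟨_, ?_, a, l, h4⟩
  rw [List.length_cons]
  have : s * (x.length + 1 + s) ≤ t * (x.length + 1 + t) := by gcongr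
  omega

end OracleTM

/-- A configuration without a state or with an empty queue is fixed, so none can occur on the way to
`d`. -/
theorem QueueMachine.exists_of_persistent {Q : QueueMachine} {c d : Option Q.S × List Q.L} {m : ℕ}
    (h : Reaches Q.step c m d) (hd : ∀ n, ∃ s a l, Q.step^[n] d = (some s, a :: l)) (n : ℕ) :
    ∃ s a l, Q.step^[n] c = (some s, a :: l) := by
  unfold Reaches at h
  rcases le_total m n with h2 | h2
  · obtain ⟨n, rfl⟩ := Nat.exists_eq_add_of_le h2
    rw [Nat.add_comm, Function.iterate_add_apply, h]
    exact hd n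
  · obtain ⟨k, rfl⟩ := Nat.exists_eq_add_of_le h2
    obtain ⟨s, a, l, h3⟩ := hd 0
    rw [Function.iterate_zero, id] at h3
    rw [h3, Nat.add_comm, Function.iterate_add_apply] at h
    rcases e : Q.step^[n] c with ⟨_ | s, _ | ⟨a', l'⟩⟩
    · rw [e, Function.iterate_fixed (QueueMachine.step_nil _)] at h
      cases h
    · rw [e, Function.iterate_fixed (QueueMachine.step_none _)] at h
      cases h
    · rw [e, Function.iterate_fixed (QueueMachine.step_nil _)] at h
      cases h
    · exact ⟨s, a', l', rfl⟩

namespace OracleTM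

variable {M : OracleTM} {F : Answerer}

theorem queueMachine_idle (a : M.QLetter) (l : List M.QLetter) (n : ℕ) :
    ∃ a' l', (M.queueMachine F).step^[n] (some (idleState M F), a :: l) =
      (some (idleState M F), a' :: l') := by
  induction n generalizing a l with
  | zero => exact ⟨a, l, rfl⟩
  | succ n ih =>
    rw [Function.iterate_succ_apply]
    have h : (M.queueMachine F).step (some (idleState M F), a :: l) =
        (some (idleState M F), l ++ [a]) := by
      rcases a with i | _ | ⟨_ | _, c⟩ <;> rfl
    rw [h]
    rcases l with _ | ⟨b, l⟩
    · exact ih a []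
    · exact ih b (l ++ [a])

/-- If `M` accepts, the queue machine never stops. -/
theorem queueMachine_of_accept {O : Set (List Bool)} {x : List Bool} (hx : x ≠ []) {t : ℕ}
    (hF : ∀ s, AnswersIn F O (M.cfgAt O x s)) (h : M.HaltsWithin O x t true) (n : ℕ) :
    ∃ s a l, (M.queueMachine F).step^[n] (queueStart M F x) = (some s, a :: l) := by
  obtain ⟨m, -, a, l, h1⟩ := queueMachine_halt (F := F) hx hF h
  rw [if_pos rfl] at h1
  refine QueueMachine.exists_of_persistent h1 (fun n => ?_) n
  obtain ⟨a', l', h2⟩ := queueMachine_idle (F := F) a l n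
  exact ⟨_, a', l', h2⟩

end OracleTM

/-! ### The problem -/

/-- The universal machine, stopped by the clock. -/
def clockedUniversal : BitMachine := BitMachine.par universal clock fun a b => a.or b

/-- The machine that decides the problem: it runs the universal machine, stopped by the clock, if
the length of the input is in `sparseSet`, and rejects otherwise. -/
def solver : BitMachine :=
  BitMachine.par clockedUniversal lengthMachine fun a b =>
    a.bind fun a => b.map fun b => a && b

/-- The clock runs for at least `2^k` steps, and `Option.or` prefers the universal machine in a tie,
so acceptance within `2^k` steps is never lost. -/
theorem clockedUniversal_halts (x : List Bool) : ∃ T b,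
    T ≤ 2 * x.length + 2 +
      (2 ^ leadingOnes x * (2 * leadingOnes x + 2) + 2 * leadingOnes x + 2) ∧
    clockedUniversal.verdict (clockedUniversal.run x T) = some b ∧
    (b = true → universal.Accepts x) ∧
    ∀ t ≤ 2 ^ leadingOnes x, universal.verdict (universal.run x t) = some true → b = true := by
  classical
  obtain ⟨T, h1, h2, h3, h4⟩ := clock_spec x
  set v : ℕ → Option Bool := fun t =>
    (universal.verdict (universal.run x t)).or (clock.verdict (clock.run x t)) with hv
  have h5 : ∃ t, v t ≠ none := ⟨T, by simp [hv, h4 T le_rfl]⟩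
  have h6 : Nat.find h5 ≤ T := Nat.find_min' h5 (by simp [hv, h4 T le_rfl])
  have h7 := Nat.find_spec h5
  have h8 : ∀ s < Nat.find h5, v s = none := fun s hs => not_not.1 (Nat.find_min h5 hs)
  set t₀ := Nat.find h5
  obtain ⟨b, hb⟩ := Option.ne_none_iff_exists'.1 h7
  refine ⟨2 * x.length + 2 + t₀, b, by omega, ?_, ?_, ?_⟩
  · rw [clockedUniversal, BitMachine.par_verdict h8]
    exact hb
  · rintro rfl
    rcases e : universal.verdict (universal.run x t₀) with _ | b
    · rcases e' : clock.verdict (clock.run x t₀) with _ | b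
      · simp [hv, e, e'] at hb
      · have := BitMachine.verdict_unique e' (h4 T le_rfl)
        simp [hv, e, e', this] at hb
    · simp only [hv, e, Option.some_or, Option.some.injEq] at hb
      exact ⟨t₀, by rw [e, hb]⟩
  · intro t ht htv
    have h9 : t₀ ≤ t := Nat.find_min' h5 (by simp [hv, htv])
    rcases e : universal.verdict (universal.run x t₀) with _ | b'
    · rcases Nat.lt_or_ge t₀ T with h10 | h10
      · simp [hv, e, h3 t₀ h10] at hb
      -- Here `t ≤ 2 ^ leadingOnes x ≤ T ≤ t₀ ≤ t`.
      · obtain rfl : t = t₀ := by omega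
        rw [htv] at e
        cases e
    · simp only [hv, e, Option.some_or, Option.some.injEq] at hb
      rw [← hb]
      exact BitMachine.verdict_unique e htv

theorem solver_halts (x : List Bool) : ∃ T b,
    T ≤ 5 * x.length + 6 + 2 * leadingOnes x + 2 ^ leadingOnes x * (2 * leadingOnes x + 2) ∧
    solver.verdict (solver.run x T) = some b ∧
    (b = true → x.length ∈ sparseSet ∧ universal.Accepts x) ∧
    (x.length ∈ sparseSet → ∀ t ≤ 2 ^ leadingOnes x,
      universal.verdict (universal.run x t) = some true → b = true) := by
  classical
  obtain ⟨T, b, h1, h2, h3, h4⟩ := clockedUniversal_halts x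
  have h5 := lengthMachine_spec x
  set v : ℕ → Option Bool := fun t =>
    (clockedUniversal.verdict (clockedUniversal.run x t)).bind fun a =>
      (lengthMachine.verdict (lengthMachine.run x t)).map fun b => a && b with hv
  have h6 : v (max T x.length) ≠ none := by
    simp [hv, BitMachine.verdict_of_le h2 (le_max_left _ _),
      BitMachine.verdict_of_le h5 (le_max_right _ _)]
  have h7 : ∃ t, v t ≠ none := ⟨_, h6⟩
  have h8 : Nat.find h7 ≤ max T x.length := Nat.find_min' h7 h6
  have h9 := Nat.find_spec h7
  have h10 : ∀ s < Nat.find h7, v s = none := fun s hs => not_not.1 (Nat.find_min h7 hs)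
  set t₀ := Nat.find h7
  have h11 : v t₀ = some (b && decide (x.length ∈ sparseSet)) := by
    rcases e : clockedUniversal.verdict (clockedUniversal.run x t₀) with _ | b₁
    · simp [hv, e] at h9
    · rcases e' : lengthMachine.verdict (lengthMachine.run x t₀) with _ | b₂
      · simp [hv, e, e'] at h9
      · have h12 := BitMachine.verdict_unique e h2
        have h13 := BitMachine.verdict_unique e' h5
        simp [hv, e, e', h12, h13]
  refine ⟨2 * x.length + 2 + t₀, b && decide (x.length ∈ sparseSet), ?_, ?_, ?_, ?_⟩
  · have := max_le_add_of_nonneg (Nat.zero_le T) (Nat.zero_le x.length)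
    omega
  · rw [solver, BitMachine.par_verdict h10]
    exact h11
  · intro h
    rw [Bool.and_eq_true, decide_eq_true_iff] at h
    exact ⟨h.2, h3 h.1⟩
  · intro h t ht htv
    rw [h4 t ht htv, Bool.true_and, decide_eq_true_iff]
    exact h

/-- A problem with a hard instance for every Turing kernelization of subexponential size. -/
def hardProblem : ParamProblem where
  X := {x | solver.Accepts x}
  κ := leadingOnes
  polyTime_κ := polyTimeComputable_leadingOnes
  κ_le_length := leadingOnes_le_length

theorem mem_hardProblem_imp {x : List Bool} (h : x ∈ hardProblem.X) :
    x.length ∈ sparseSet ∧ universal.Accepts x := by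
  obtain ⟨t, ht⟩ := h
  obtain ⟨T, b, -, h2, h3, -⟩ := solver_halts x
  exact h3 (BitMachine.verdict_unique h2 ht)

/-- The exact stopping time of the clock never matters: on the diagonal instances, the universal
machine accepts within `2^k` steps or never. -/
theorem mem_hardProblem {x : List Bool} (h : x.length ∈ sparseSet) {t : ℕ}
    (ht : t ≤ 2 ^ leadingOnes x) (hx : universal.verdict (universal.run x t) = some true) :
    x ∈ hardProblem.X := by
  obtain ⟨T, b, -, h2, -, h3⟩ := solver_halts x
  rw [h3 h t ht hx] at h2
  exact ⟨T, h2⟩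

theorem solvableInTwoPowMul_hardProblem : hardProblem.SolvableInTwoPowMul := by
  -- For `n > 0`, `2^k (2k + 2) ≤ 4 · 2^k n` and `5n + 2k ≤ 7 · 2^k n`, hence `11`; for `n = 0`, the
  -- bound of `solver_halts` is `8`.
  refine ⟨solver.toOracleTM none, solver.oracleFree_toOracleTM none, 11, fun x => ?_⟩
  obtain ⟨T, b, h1, h2, -, -⟩ := solver_halts x
  refine ⟨b, BitMachine.haltsWithin_toOracleTM _ (BitMachine.verdict_of_le h2 (h1.trans ?_)), ?_⟩
  · change _ ≤ 11 * (2 ^ leadingOnes x * x.length) + 11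
    have h3 := leadingOnes_le_length x
    have h4 := Nat.one_le_two_pow (n := leadingOnes x)
    rcases Nat.eq_zero_or_pos x.length with h5 | h5
    · have h6 : leadingOnes x = 0 := by omega
      simp [h5, h6]
    · have h6 : 2 ^ leadingOnes x * (2 * leadingOnes x + 2) ≤
          2 ^ leadingOnes x * (4 * x.length) := by gcongr; omega
      have h7 : 1 * x.length ≤ 2 ^ leadingOnes x * x.length := by gcongr
      nlinarith
  · exact ⟨fun h => ⟨T, h ▸ h2⟩, fun ⟨t, ht⟩ => BitMachine.verdict_unique h2 ht⟩

/-! ### Answers to short queries -/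

/-- Words of length at most `m + 1`. -/
abbrev ShortWord (m : ℕ) := {l : List Bool // l.length ≤ m + 1}

/-- A word as a function on positions. -/
def ShortWord.toFun {m : ℕ} (w : ShortWord m) : Fin (m + 1) → Option Bool := fun i => w.1[(i : ℕ)]?

theorem ShortWord.toFun_injective (m : ℕ) :
    Function.Injective (ShortWord.toFun : ShortWord m → Fin (m + 1) → Option Bool) := by
  intro w w' h
  refine Subtype.ext (List.ext_getElem? fun i => ?_)
  by_cases hi : i < m + 1
  · exact congrFun h ⟨i, hi⟩
  · rw [List.getElem?_eq_none (by have := w.2; omega),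
      List.getElem?_eq_none (by have := w'.2; omega)]

instance (m : ℕ) : Finite (ShortWord m) := Finite.of_injective _ (ShortWord.toFun_injective m)

theorem card_shortWord_le (m : ℕ) : Nat.card (ShortWord m) ≤ 3 ^ (m + 1) := by
  refine (Nat.card_le_card_of_injective _ (ShortWord.toFun_injective m)).trans ?_
  simp

/-- The empty word. -/
def ShortWord.nil (m : ℕ) : ShortWord m := ⟨[], by simp⟩

/-- Append a letter, unless the word is full. -/
def ShortWord.push {m : ℕ} (w : ShortWord m) (b : Bool) : ShortWord m :=
  ⟨(w.1 ++ [b]).take (m + 1), by simp⟩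

theorem ShortWord.foldl_push {m : ℕ} (w : List Bool) (a : ShortWord m) :
    (w.foldl ShortWord.push a).1 = (a.1 ++ w).take (m + 1) := by
  induction w generalizing a with
  | nil => simp [List.take_of_length_le a.2]
  | cons b w ih =>
    rw [List.foldl_cons, ih]
    change ((a.1 ++ [b]).take (m + 1) ++ w).take (m + 1) = _
    have h := a.2
    rcases Nat.lt_or_ge a.1.length (m + 1) with h1 | h1
    · rw [List.take_of_length_le (l := a.1 ++ [b]) (by simpa using h1)]
      simp
    · rw [List.take_append_of_le_length h1, List.take_append_of_le_length (by simp; omega),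
        List.take_append_of_le_length h1, List.take_take, min_self]

open Classical in
/-- An automaton that recognizes the words of `X` with at most `m` letters. -/
noncomputable def shortAnswerer (X : Set (List Bool)) (m : ℕ) : Answerer where
  R := ShortWord m
  start := ShortWord.nil m
  push := ShortWord.push
  ans w := decide (w.1.length ≤ m ∧ w.1 ∈ X)

theorem shortAnswerer_ans_eq_true_iff (X : Set (List Bool)) (m : ℕ) (a : ShortWord m) :
    (shortAnswerer X m).ans a = true ↔ a.1.length ≤ m ∧ a.1 ∈ X := by
  classical
  change decide (a.1.length ≤ m ∧ a.1 ∈ X) = true ↔ _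
  exact decide_eq_true_iff

/-- Words are truncated after `m + 1` letters, one more than needed, so that words longer than `m`
can be told apart and rejected. This is correct for `w` because of `h`. -/
theorem shortAnswerer_ans (X : Set (List Bool)) (m : ℕ) (w : List Bool)
    (h : w ∈ X → w.length ≤ m) :
    (shortAnswerer X m).ans (w.foldl (shortAnswerer X m).push (shortAnswerer X m).start) = true ↔
      w ∈ X := by
  refine (shortAnswerer_ans_eq_true_iff X m (w.foldl ShortWord.push (ShortWord.nil m))).trans ?_
  rw [ShortWord.foldl_push, show (ShortWord.nil m).1 = [] from rfl, List.nil_append]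
  constructor
  · rintro ⟨h2, h3⟩
    rw [List.length_take] at h2
    rwa [List.take_of_length_le (by omega)] at h3
  · intro h2
    have h3 := h h2
    rw [List.take_of_length_le (by omega)]
    exact ⟨h3, h2⟩

/-! ### Lower bound -/

theorem eval_le_pow (p : Polynomial ℕ) : ∃ e, ∀ n, p.eval n ≤ (n + 2) ^ e := by
  induction p using Polynomial.induction_on' with
  | add p q hp hq =>
    obtain ⟨a, ha⟩ := hp
    obtain ⟨b, hb⟩ := hq
    refine ⟨max a b + 1, fun n => ?_⟩
    rw [Polynomial.eval_add, pow_succ]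
    have h1 := (ha n).trans (Nat.pow_le_pow_right (by omega) (le_max_left a b))
    have h2 := (hb n).trans (Nat.pow_le_pow_right (by omega) (le_max_right a b))
    nlinarith
  | monomial d c =>
    refine ⟨c + d, fun n => ?_⟩
    rw [Polynomial.eval_monomial, pow_add]
    refine Nat.mul_le_mul ?_ (Nat.pow_le_pow_left (by omega) d)
    exact c.lt_two_pow_self.le.trans (Nat.pow_le_pow_left (by omega) c)

/-- The size of programs that simulate `M` with the answers to queries of length at most `m` is at
most exponential in `m`. -/
theorem exists_program_bound (M : OracleTM) : ∃ c, ∀ X m,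
    4 * (encProgram (M.queueMachine (shortAnswerer X m)).records).length ≤ 2 ^ (c * (m + 1)) := by
  set A := Nat.card M.Column
  set B := Nat.card M.Control
  set C := Nat.card (Option (Bool × M.Column))
  set D := 40 * ((2 + A + 2 * B) * (3 + C)) ^ 2 with hD
  -- Only the factor `3 ^ (m + 1)` in the number of states depends on `m`. Squaring gives `9 ^ (m +
  -- 1)`, at most `2 ^ (4 * (m + 1))`; and `D ≤ 2 ^ D`.
  refine ⟨D + 4, fun X m => ?_⟩
  have h1 := QueueMachine.length_encProgram_le (M := M.queueMachine (shortAnswerer X m))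
    fun s a => M.length_queueδ_le (shortAnswerer X m) s a
  have h2 : (M.queueMachine (shortAnswerer X m)).nS ≤ (2 + A + 2 * B) * 3 ^ (m + 1) := by
    change 1 + Nat.card (Option M.Column ⊕ (M.Control × (ShortWord m × Bool))) ≤ _
    rw [Nat.card_sum, Nat.card_prod, Nat.card_prod, Finite.card_option]
    have h3 := card_shortWord_le m
    have h4 : 1 ≤ 3 ^ (m + 1) := Nat.one_le_pow _ _ (by norm_num)
    have h5 : Nat.card Bool = 2 := by simp
    rw [h5]
    have h6 : B * (Nat.card (ShortWord m) * 2) ≤ B * (3 ^ (m + 1) * 2) := by gcongr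
    nlinarith
  have h3 : (M.queueMachine (shortAnswerer X m)).nL = 3 + C := rfl
  have h4 : (encProgram (M.queueMachine (shortAnswerer X m)).records).length ≤
      10 * ((2 + A + 2 * B) * 3 ^ (m + 1) * (3 + C)) ^ 2 := by
    rw [h3] at h1
    exact h1.trans (by gcongr)
  calc 4 * (encProgram (M.queueMachine (shortAnswerer X m)).records).length
      ≤ 4 * (10 * ((2 + A + 2 * B) * 3 ^ (m + 1) * (3 + C)) ^ 2) := by gcongr
    _ = D * 9 ^ (m + 1) := by
        rw [hD, show (9 : ℕ) = 3 ^ 2 by norm_num, pow_right_comm]; ring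
    _ ≤ 2 ^ (D * (m + 1)) * 16 ^ (m + 1) := by
        refine Nat.mul_le_mul ?_ (Nat.pow_le_pow_left (by norm_num) _)
        exact D.lt_two_pow_self.le.trans
          (Nat.pow_le_pow_right (by norm_num) (Nat.le_mul_of_pos_right _ (by omega)))
    _ = 2 ^ ((D + 4) * (m + 1)) := by
        rw [show (16 : ℕ) = 2 ^ 4 by norm_num, ← pow_mul, ← pow_add]; ring_nf

/-- For large `n`, some `k` satisfies all requirements on the parameter. -/
theorem exists_parameter {g : ℕ → ℕ} (hg : SubexponentialGrowth g) (e : ℕ) :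
    ∃ N, ∀ n, N ≤ n → ∃ k, (n + 2) ^ e ≤ 2 ^ k ∧ g k < n ∧ 2 * (k + 1) ≤ n := by
  obtain ⟨h, ho, hgh⟩ := hg
  have hε : (0 : ℝ) < 1 / (2 * (e + 1)) := by positivity
  obtain ⟨K, hK⟩ := eventually_atTop.1 ((ho.def hε).and hgh)
  -- With `l = Nat.log 2 n` and `k = (e + 1) * (l + 2)`, `2 ^ k ≥ (n + 2) ^ e`. As `|h k| ≤ k / (2 *
  -- (e + 1)) = (l + 2) / 2`, `g k ≤ 2 ^ ((l + 2) / 2) < 2 ^ l ≤ n`. The threshold ensures `k ≥ K`,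
  -- and lets `mul_le_two_pow` show that `k` is small compared to `n`.
  refine ⟨2 ^ (K + 12 * (e + 1) + 20), fun n hn => ⟨(e + 1) * (Nat.log 2 n + 2), ?_, ?_, ?_⟩⟩
  all_goals
    have hl : K + 12 * (e + 1) + 20 ≤ Nat.log 2 n := Nat.le_log_of_pow_le (by norm_num) hn
    have h0 : n ≠ 0 := by
      have := Nat.one_le_two_pow (n := K + 12 * (e + 1) + 20)
      omega
    have h1 : 2 ^ Nat.log 2 n ≤ n := Nat.pow_log_le_self 2 h0
    set l := Nat.log 2 n with hldef
  · have h2 : n < 2 ^ (l + 1) := Nat.lt_pow_succ_log_self (by norm_num) n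
    have h3 : n + 2 ≤ 2 ^ (l + 2) := by
      have := Nat.one_le_two_pow (n := l)
      rw [pow_succ] at h2 ⊢
      rw [pow_succ]
      omega
    calc (n + 2) ^ e ≤ (2 ^ (l + 2)) ^ e := Nat.pow_le_pow_left h3 e
      _ = 2 ^ (e * (l + 2)) := by rw [← pow_mul, mul_comm]
      _ ≤ _ := Nat.pow_le_pow_right (by norm_num) (by gcongr; omega)
  · obtain ⟨h2, h3⟩ := hK ((e + 1) * (l + 2)) (by nlinarith)
    have h4 : h ((e + 1) * (l + 2)) ≤ (l + 2) / 2 := by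
      refine (Real.le_norm_self _).trans (h2.trans (le_of_eq ?_))
      rw [Real.norm_of_nonneg (by positivity)]
      push_cast
      field_simp
    have h5 : (g ((e + 1) * (l + 2)) : ℝ) < n := by
      calc (g ((e + 1) * (l + 2)) : ℝ) ≤ 2 ^ h ((e + 1) * (l + 2)) := h3
        _ ≤ (2 : ℝ) ^ (((l : ℝ) + 2) / 2) := Real.rpow_le_rpow_of_exponent_le (by norm_num) h4
        _ < (2 : ℝ) ^ (l : ℝ) := by
            refine Real.rpow_lt_rpow_of_exponent_lt (by norm_num) ?_
            have : (20 : ℝ) ≤ l := by exact_mod_cast (by omega : 20 ≤ l)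
            linarith
        _ ≤ n := by rw [Real.rpow_natCast]; exact_mod_cast h1
    exact_mod_cast h5
  · have h2 := mul_le_two_pow (c := 4 * (e + 1) + 2) (w := l) (by omega)
    refine le_trans ?_ (h2.trans h1)
    nlinarith

/-- The order of choices matters: `M` and its time bound determine `c` and `e`, these determine `N`,
and only then `m`, `n` and `k` are chosen. So the program, which depends on `m`, fits into an
instance of length `n`. -/
theorem not_hasTuringKernelization_hardProblem {g : ℕ → ℕ} (hg : SubexponentialGrowth g) :
    ¬ hardProblem.HasTuringKernelization g := by
  rintro ⟨M, ⟨p, hp⟩, hM⟩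
  obtain ⟨c, hc⟩ := exists_program_bound M
  -- `q` bounds the number of queue steps (`queueMachine_halt`); the polynomial in the next line
  -- bounds the time of the universal machine.
  set q : Polynomial ℕ := Polynomial.X + 1 + p * (Polynomial.X + p) with hq
  obtain ⟨e, he⟩ := eval_le_pow (q * (10 * Polynomial.X + 2 * q * Polynomial.X + 17) +
    7 * Polynomial.X + 7)
  obtain ⟨N, hN⟩ := exists_parameter hg e
  obtain ⟨m, n, hn, hnS, hgap, hmn⟩ := sparseSet_gap c N
  obtain ⟨k, hk1, hk2, hk3⟩ := hN n hn
  set F := shortAnswerer hardProblem.X m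
  set P := encProgram (M.queueMachine F).records with hP
  have hPn : 4 * P.length ≤ n := (hc hardProblem.X m).trans hmn
  -- There is room, as `k + 1 ≤ n / 2` and `P.length ≤ n / 4`.
  set pad := List.replicate (n - (k + 1 + P.length)) false with hpad
  set x := List.replicate k true ++ false :: (P ++ pad) with hx
  have hxn : x.length = n := by
    simp only [hx, hpad, List.length_append, List.length_cons, List.length_replicate]
    omega
  have hxk : leadingOnes x = k := leadingOnes_replicate_append k _
  have hxP : programPart false x = encProgram (M.queueMachine F).records ++ pad :=
    programPart_replicate_append k _
  have hpad' : pad.head? ≠ some true := by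
    rw [hpad]
    cases n - (k + 1 + P.length) <;> simp [List.replicate_succ]
  have hx0 : x ≠ [] := by simp [hx]
  have hF : ∀ s, OracleTM.AnswersIn F hardProblem.X (M.cfgAt hardProblem.X x s) := by
    intro s y z ha
    refine shortAnswerer_ans hardProblem.X m _ fun hw => ?_
    have h1 := hM x _ ⟨s, y, z, ha, rfl⟩
    change _ ≤ g (leadingOnes x) at h1
    rw [hxk] at h1
    -- A query with answer yes has a length in `sparseSet`, and at most `g k < n`; the gap pushes it
    -- down to `m`.
    exact hgap _ (mem_hardProblem_imp hw).1 (by omega)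
  have hstart := M.isStart_queueMachine F
  obtain ⟨b, hb1, hb2⟩ := hp x
  cases b with
  | true =>
    refine hstart.universal_not_accepts hxP ?_ (mem_hardProblem_imp (hb2.1 rfl)).2
    exact OracleTM.queueMachine_of_accept hx0 hF hb1
  | false =>
    obtain ⟨s, hs, a, l, h1⟩ := OracleTM.queueMachine_halt hx0 hF hb1
    obtain ⟨t, ht, h2⟩ := hstart.universal_accepts hpad' hxP h1
    refine absurd (hb2.2 (mem_hardProblem (hxn ▸ hnS) ?_ h2)) (by simp)
    rw [hxk]
    refine ht.trans (le_trans ?_ ((he n).trans hk1))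
    rw [hxn] at hs ⊢
    have h3 : s ≤ q.eval n := by
      simpa [hq, hxn] using hs
    simp only [Polynomial.eval_add, Polynomial.eval_mul, Polynomial.eval_X,
      Polynomial.eval_ofNat]
    gcongr

theorem subexponentialGrowth_polynomial (p : Polynomial ℕ) :
    SubexponentialGrowth fun k => p.eval k := by
  obtain ⟨e, he⟩ := eval_le_pow p
  -- The exponent is `e` times the binary logarithm of `k + 2`.
  refine ⟨fun k => e / Real.log 2 * Real.log (k + 2), ?_, Eventually.of_forall fun k => ?_⟩
  · refine IsLittleO.const_mul_left ?_ _
    have h1 : Tendsto (fun k : ℕ => (k : ℝ) + 2) atTop atTop :=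
      tendsto_atTop_add_const_right _ _ tendsto_natCast_atTop_atTop
    refine (Real.isLittleO_log_id_atTop.comp_tendsto h1).trans_isBigO ?_
    refine IsBigO.of_bound 3 (eventually_atTop.2 ⟨1, fun k hk => ?_⟩)
    have hk' : (1 : ℝ) ≤ k := by exact_mod_cast hk
    simp only [Function.comp_apply, id]
    rw [Real.norm_of_nonneg (by positivity), Real.norm_of_nonneg (by positivity)]
    linarith
  · have h1 : (2 : ℝ) ^ (e / Real.log 2 * Real.log (k + 2)) = (k + 2) ^ e := by
      have h2 : (0 : ℝ) < Real.log 2 := Real.log_pos (by norm_num)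
      rw [Real.rpow_def_of_pos (by norm_num), ← mul_assoc, mul_div_cancel₀ _ h2.ne', mul_comm,
        Real.exp_mul, Real.exp_log (by positivity), Real.rpow_natCast]
    change ((p.eval k : ℕ) : ℝ) ≤ (2 : ℝ) ^ (e / Real.log 2 * Real.log (k + 2))
    rw [h1]
    exact_mod_cast he k

end ParamComplexity

theorem theorem5 :
    (∀ g : ℕ → ℕ, ParamComplexity.TimeConstructible g → ParamComplexity.SubexponentialGrowth g →
      ∃ P : ParamComplexity.ParamProblem,
        P.SolvableInTwoPowMul ∧ ¬ P.HasTuringKernelization g) ∧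
    (∃ P : ParamComplexity.ParamProblem,
      P.SolvableInTwoPowMul ∧ ¬ P.HasPolynomialTuringKernelization) :=
  ⟨fun _ _ hg => ⟨ParamComplexity.hardProblem, ParamComplexity.solvableInTwoPowMul_hardProblem,
    ParamComplexity.not_hasTuringKernelization_hardProblem hg⟩,
    ParamComplexity.hardProblem, ParamComplexity.solvableInTwoPowMul_hardProblem,
    fun ⟨p, hp⟩ => ParamComplexity.not_hasTuringKernelization_hardProblem
      (ParamComplexity.subexponentialGrowth_polynomial p) hp⟩
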